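/- **Setting.** Let $F:\emptyset=K_0\subset K_1\subset\cdots\subset K_m=K$ be a simplex-wise filtration of a finite simplicial complex, where $K_{i+1}$ is obtained from $K_i$ by adding one simplex $\sigma_i$. Homology is unreduced, with real coefficients, and simplices are oriented by a fixed total order on the vertices. Chains and cochains are identified through the basis of simplices, and chains of $K_i$ are regarded as chains of $K$. Let $\mathrm{Har}_p(K_i)=Z_p(K_i)\cap Z^p(K_i)$ be the space of $p$-chains that are both cycles and cocycles of $K_i$, and let $\mathrm{Har}(K_i)=\bigoplus_p\mathrm{Har}_p(K_i)$. Call $\sigma_i$ *positive* if $\dim \mathrm{Har}(K_{i+1})=\dim\mathrm{Har}(K_i)+1$, and *negative* if $\dim \mathrm{Har}(K_{i+1})=\dim\mathrm{Har}(K_i)-1$. Consecutive spaces $\mathrm{Har}_p(K_i)$, $\mathrm{Har}_p(K_{i+1})$ are nested in one direction or the other, and so are $\mathrm{Har}(K_i)$, $\mathrm{Har}(K_{i+1})$. With the inclusions as arrows they form zigzag modules $\mathrm{Har}_p(F)$ and $\mathrm{Har}(F)$. The *harmonic chain barcodes* $\mathsf B^{\mathrm{Har}}_p(F)$ and $\mathsf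 B^{\mathrm{Har}}(F)$ are the multisets of intervals in the decompositions of these modules into interval modules $I[b,d]$. For an interval $[b,d]\subseteq[0,m]$ with $b>0$, a *partial $p$-representative* is a chain $z$ with $z\in\mathrm{Har}_p(K_i)$ for all $i\in[b,d]$ and $z\notin\mathrm{Har}_p(K_{b-1})$. It is a *harmonic $p$-representative* if moreover $z\notin\mathrm{Har}_p(K_{d+1})$ in the case $d<m$. **Algorithm.** For each $p$ maintain a set $U^p$ of unpaired births, initially empty, and a chain $z_b$ for each $b\in U^p$. For $i=0,\dots,m-1$ process the $p$-simplex $\sigma_i$ as follows. * If $\sigma_i$ is positive, choose any $z\in\mathrm{Har}_p(K_{i+1})\setminus\mathrm{Har}_p(K_i)$, add $i+1$ to $U^p$, and set $z_{i+1}:=z$. * If $\sigma_i$ is negative, let $U'=\{b\in U^{p-1}: z_b\notin\mathrm{Har}_{p-1}(K_{i+1})\}$ and $b_*=\min U'$. Output the interval $[b_*,i]$ in degree $p-1$ with representative $z_{b_*}$, and remove $b_*$ from $U^{p-1}$. For every $b\in U'\setminus\{b_*\}$ replace $z_b$ by $z_b-(\alpha_b/\alpha_*)\,z_{b_*}$,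 where $\alpha_b=z_b(\partial\sigma_i)$ and $\alpha_*=z_{b_*}(\partial\sigma_i)$. At the end, for every $p$ and every $b\in U^p$, output $[b,m]$ in degree $p$ with representative $z_b$. **Theorem.** The algorithm correctly computes the harmonic chain barcode, whatever choices are made in the positive steps. Precisely: 1. Every iteration can be carried out. Each $\sigma_i$ is positive or negative. In the positive case a chain $z$ as required exists. In the negative case $\dim \sigma_i\ge1$, $U'\neq\emptyset$ and $\alpha_*\ne0$. 2. For every $i\le m$, after $\sigma_0,\dots,\sigma_{i-1}$ have been processed, $z_b$ is a partial $p$-representative for $[b,i]$, for every $p$ and every $b\in U^p$. 3. At the end the multiset of the intervals output in degree $p$ is $\mathsf B^{\mathrm{Har}}_p(F)$ for every $p$, and the multiset of all output intervals is $\mathsf B^{\mathrm{Har}}(F)$. (That is, the module decomposes into these intervals, and any interval decomposition has this multiset of intervals.) Each output interval $[b,d]$ in degree $p$ comes with a harmonic $p$-representative for $[b,d]$. -/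

import Mathlib

noncomputable section

open scoped DirectSum

namespace HarmonicChain

universe u v

/-! ### Simplicial chains and harmonic chains -/

/-- Real chains (identified with cochains) on the finite subsets of a vertex set `V`: the chain
groups of every simplicial complex with vertices in `V` are subspaces of this space. -/
abbrev Chain (V : Type u) : Type u := Finset V →₀ ℝ

section Chains

variable {V : Type u} [LinearOrder V]

/-- The boundary of a simplex `v₀ < v₁ < ⋯ < v_p`: the alternating sum `∑ (-1)^q [v₀ ⋯ v̂_q ⋯ v_p]`
of its facets if `p ≥ 1`, and zero for a vertex (homology is not reduced). The position `q` of a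
vertex `v` is the number of vertices of the simplex that are smaller than `v`. -/
def simplexBoundary (s : Finset V) : Chain V :=
  if 2 ≤ s.card then
    ∑ v ∈ s, Finsupp.single (s.erase v) ((-1 : ℝ) ^ (s.filter (fun w => w < v)).card)
  else 0

/-- The boundary operator `∂`. -/
def boundary : Chain V →ₗ[ℝ] Chain V := Finsupp.linearCombination ℝ simplexBoundary

/-- The coboundary operator `δ`: the value `(δ z)(τ) = z(∂ τ)`, where the cochain `z` is
extended linearly from simplices to chains. Within a complex `K` only simplices `τ ∈ K` count. -/
def coboundary (z : Chain V) (τ : Finset V) : ℝ :=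
  Finsupp.linearCombination ℝ (fun s => z s) (simplexBoundary τ)

theorem coboundary_add (z w : Chain V) (τ : Finset V) :
    coboundary (z + w) τ = coboundary z τ + coboundary w τ := by
  simp [coboundary, Finsupp.linearCombination_apply, Finsupp.sum, mul_add,
    Finset.sum_add_distrib]

theorem coboundary_smul (a : ℝ) (z : Chain V) (τ : Finset V) :
    coboundary (a • z) τ = a * coboundary z τ := by
  simp [coboundary, Finsupp.linearCombination_apply, Finsupp.sum, Finset.mul_sum, mul_left_comm]

/-- The chain group `C_p(K)`, identified with the cochain group `C^p(K)`. -/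
def chainGroup (K : PreAbstractSimplicialComplex V) (p : ℕ) : Submodule ℝ (Chain V) :=
  Finsupp.supported ℝ ℝ {s | s ∈ K ∧ s.card = p + 1}

/-- The cycle group `Z_p(K)`. -/
def cycleGroup (K : PreAbstractSimplicialComplex V) (p : ℕ) : Submodule ℝ (Chain V) :=
  chainGroup K p ⊓ LinearMap.ker boundary

/-- The cocycle group `Z^p(K)`: the `p`-cochains of `K` whose coboundary vanishes on all
`(p+1)`-simplices of `K`. -/
def cocycleGroup (K : PreAbstractSimplicialComplex V) (p : ℕ) : Submodule ℝ (Chain V) where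
  carrier := {z | z ∈ chainGroup K p ∧ ∀ τ ∈ K, τ.card = p + 2 → coboundary z τ = 0}
  zero_mem' := ⟨Submodule.zero_mem _, fun τ _ _ => by
    simp [coboundary, Finsupp.linearCombination_apply]⟩
  add_mem' := fun {a b} ha hb => ⟨Submodule.add_mem _ ha.1 hb.1, fun τ hτ hc => by
    rw [coboundary_add, ha.2 τ hτ hc, hb.2 τ hτ hc, add_zero]⟩
  smul_mem' := fun r a ha => ⟨Submodule.smul_mem _ r ha.1, fun τ hτ hc => by
    rw [coboundary_smul, ha.2 τ hτ hc, mul_zero]⟩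

/-- The `p`-th harmonic chain group `Har_p(K) = Z_p(K) ∩ Z^p(K)`. -/
def har (K : PreAbstractSimplicialComplex V) (p : ℕ) : Submodule ℝ (Chain V) :=
  cycleGroup K p ⊓ cocycleGroup K p

/-- The harmonic chain group `Har(K) = ⨁_p Har_p(K)` in all dimensions, as the (internal, direct)
sum of the subspaces `Har_p(K)`. -/
def harTotal (K : PreAbstractSimplicialComplex V) : Submodule ℝ (Chain V) :=
  ⨆ p, har K p

/-- The sum that defines `harTotal` is direct. -/
theorem iSupIndep_har (K : PreAbstractSimplicialComplex V) : iSupIndep (har K) := by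
  have h : iSupIndep (fun p : ℕ =>
      Finsupp.supported ℝ ℝ {s : Finset V | s ∈ K ∧ s.card = p + 1}) := by
    intro p
    have hle : (⨆ j, ⨆ (_ : j ≠ p),
        Finsupp.supported ℝ ℝ {s : Finset V | s ∈ K ∧ s.card = j + 1}) ≤
        Finsupp.supported ℝ ℝ (⋃ j, ⋃ (_ : j ≠ p), {s : Finset V | s ∈ K ∧ s.card = j + 1}) :=
      iSup₂_le fun j hj => Finsupp.supported_mono fun s hs => Set.mem_iUnion₂.2 ⟨j, hj, hs⟩
    refine Disjoint.mono_right hle ?_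
    apply Finsupp.disjoint_supported_supported
    rw [Set.disjoint_left]
    intro s hs hs'
    simp only [Set.mem_iUnion, Set.mem_ofPred_eq] at hs hs'
    obtain ⟨j, hj, -, hc⟩ := hs'
    exact hj (by omega)
  exact h.mono fun p => inf_le_left.trans inf_le_left

end Chains

/-! ### Simplex-wise filtrations -/

/-- A simplex-wise filtration `∅ = K₀ ⊂ K₁ ⊂ ⋯ ⊂ K_m`, where `K_{i+1}` arises from `K_i` by adding
the simplex `σ_i` (only `K_i` for `i ≤ m` and `σ_i` for `i < m` are relevant). -/
structure SimplexwiseFiltration (V : Type u) (m : ℕ) where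
  K : ℕ → PreAbstractSimplicialComplex V
  σ : ℕ → Finset V
  K_zero : K 0 = ⊥
  notMem : ∀ i < m, σ i ∉ K i
  step : ∀ i < m, (K (i + 1)).faces = insert (σ i) (K i).faces

namespace SimplexwiseFiltration

theorem mem_succ_iff {V : Type u} {m : ℕ} (F : SimplexwiseFiltration V m) {i : ℕ}
    (hi : i < m) (s : Finset V) :
    s ∈ F.K (i + 1) ↔ s = F.σ i ∨ s ∈ F.K i := by
  have h : s ∈ (F.K (i + 1)).faces ↔ s ∈ insert (F.σ i) (F.K i).faces := by rw [F.step i hi]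
  exact h

variable {V : Type u} [LinearOrder V] {m : ℕ} (F : SimplexwiseFiltration V m)

/-- The inserted simplex `σ_i` is positive: the dimension of `Har` goes up by one. -/
def Positive (i : ℕ) : Prop :=
  Module.finrank ℝ (harTotal (F.K (i + 1))) = Module.finrank ℝ (harTotal (F.K i)) + 1

/-- The inserted simplex `σ_i` is negative: the dimension of `Har` goes down by one. -/
def Negative (i : ℕ) : Prop :=
  Module.finrank ℝ (harTotal (F.K (i + 1))) + 1 = Module.finrank ℝ (harTotal (F.K i))

/-- Consecutive harmonic chain groups are nested, in the same direction for all degrees. -/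
theorem har_nested {i : ℕ} (hi : i < m) :
    (∀ p, har (F.K i) p ≤ har (F.K (i + 1)) p) ∨ (∀ p, har (F.K (i + 1)) p ≤ har (F.K i) p) := by
  have hmono : ∀ p, chainGroup (F.K i) p ≤ chainGroup (F.K (i + 1)) p := fun p =>
    Finsupp.supported_mono fun s hs => ⟨(F.mem_succ_iff hi s).2 (Or.inr hs.1), hs.2⟩
  by_cases h : ∃ c : Chain V, (∀ s ∈ c.support, s ∈ F.K i) ∧ boundary c = simplexBoundary (F.σ i)
  · left
    intro p z hz
    obtain ⟨c, hc, hb⟩ := h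
    have hzc : z ∈ chainGroup (F.K i) p := hz.1.1
    -- the coboundary vanishes on every simplex of the smaller complex
    have hall : ∀ τ ∈ F.K i, coboundary z τ = 0 := by
      intro τ hτ
      by_cases hcard : τ.card = p + 2
      · exact hz.2.2 τ hτ hcard
      · unfold coboundary simplexBoundary
        split_ifs with h2
        · rw [map_sum]
          refine Finset.sum_eq_zero fun v hv => ?_
          rw [Finsupp.linearCombination_single]
          have : z (τ.erase v) = 0 := by
            by_contra hne
            have := (Finsupp.mem_supported ℝ z).1 hzc (Finsupp.mem_support_iff.2 hne)
            have h1 : (τ.erase v).card = p + 1 := this.2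
            rw [Finset.card_erase_of_mem hv] at h1
            omega
          rw [this, smul_zero]
        · exact map_zero _
    refine ⟨⟨hmono p hzc, hz.1.2⟩, hmono p hzc, fun τ hτ hcard => ?_⟩
    rcases (F.mem_succ_iff hi τ).1 hτ with rfl | hτ
    · unfold coboundary
      rw [← hb, boundary, Finsupp.linearCombination_apply ℝ c, map_finsuppSum]
      refine Finset.sum_eq_zero fun τ hτ => ?_
      have h0 := hall τ (hc τ hτ)
      unfold coboundary at h0
      simp only [map_smul, h0, smul_zero]
    · exact hall τ hτ
  · right
    intro p z hz
    have hzσ : z (F.σ i) = 0 := by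
      by_contra hne
      apply h
      refine ⟨-((z (F.σ i))⁻¹ • z.erase (F.σ i)), ?_, ?_⟩
      · intro s hs
        have h1 : s ∈ (z.erase (F.σ i)).support := by
          rw [Finsupp.support_neg] at hs
          exact Finsupp.support_smul hs
        rw [Finsupp.support_erase, Finset.mem_erase] at h1
        have h2 : s ∈ F.K (i + 1) := ((Finsupp.mem_supported ℝ z).1 hz.1.1 h1.2).1
        exact ((F.mem_succ_iff hi s).1 h2).resolve_left h1.1
      · have h0 : boundary z = 0 := hz.1.2
        rw [← Finsupp.single_add_erase (F.σ i) z, map_add] at h0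
        have h1 : boundary (Finsupp.single (F.σ i) (z (F.σ i))) =
            z (F.σ i) • simplexBoundary (F.σ i) := by
          simp [boundary]
        rw [h1] at h0
        rw [map_neg, map_smul, eq_neg_of_add_eq_zero_right h0, smul_neg, neg_neg, smul_smul,
          inv_mul_cancel₀ hne, one_smul]
    have hzc : z ∈ chainGroup (F.K i) p := by
      refine (Finsupp.mem_supported ℝ z).2 fun s hs => ?_
      have h1 := (Finsupp.mem_supported ℝ z).1 hz.1.1 hs
      refine ⟨((F.mem_succ_iff hi s).1 h1.1).resolve_left ?_, h1.2⟩
      rintro rfl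
      exact (Finsupp.mem_support_iff.1 (Finset.mem_coe.1 hs)) hzσ
    exact ⟨⟨hzc, hz.1.2⟩, hzc, fun τ hτ hcard =>
      hz.2.2 τ ((F.mem_succ_iff hi τ).2 (Or.inr hτ)) hcard⟩

theorem har_nested_degree (p : ℕ) (i : ℕ) (hi : i < m) :
    har (F.K i) p ≤ har (F.K (i + 1)) p ∨ har (F.K (i + 1)) p ≤ har (F.K i) p :=
  (F.har_nested hi).imp (fun h => h p) (fun h => h p)

theorem harTotal_nested (i : ℕ) (hi : i < m) :
    harTotal (F.K i) ≤ harTotal (F.K (i + 1)) ∨ harTotal (F.K (i + 1)) ≤ harTotal (F.K i) :=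
  (F.har_nested hi).imp (fun h => iSup_mono h) (fun h => iSup_mono h)

end SimplexwiseFiltration

/-! ### Zigzag modules and their barcodes -/

/-- A zigzag module `V₀ ↔ V₁ ↔ ⋯ ↔ V_k` of real vector spaces. The arrow between `V_i` and
`V_{i+1}` points forward if `fwd i` holds, and backward otherwise. -/
structure ZigzagModule (k : ℕ) (fwd : Fin k → Prop) where
  V : Fin (k + 1) → Type v
  [addCommGroup : ∀ i, AddCommGroup (V i)]
  [module : ∀ i, Module ℝ (V i)]
  forward : ∀ i, fwd i → (V i.castSucc →ₗ[ℝ] V i.succ)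
  backward : ∀ i, ¬ fwd i → (V i.succ →ₗ[ℝ] V i.castSucc)

attribute [instance] ZigzagModule.addCommGroup ZigzagModule.module

namespace ZigzagModule

variable {k : ℕ} {fwd : Fin k → Prop}

/-- Isomorphisms of zigzag modules of the same shape: linear equivalences in every degree
that commute with all arrows. -/
structure Iso (M : ZigzagModule.{u} k fwd) (N : ZigzagModule.{v} k fwd) where
  equiv : ∀ i, M.V i ≃ₗ[ℝ] N.V i
  comm_forward : ∀ i (h : fwd i) (x : M.V i.castSucc),
    equiv i.succ (M.forward i h x) = N.forward i h (equiv i.castSucc x)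
  comm_backward : ∀ i (h : ¬ fwd i) (x : M.V i.succ),
    equiv i.castSucc (M.backward i h x) = N.backward i h (equiv i.succ x)

/-- The direct sum of a family of zigzag modules of the same shape. -/
def directSum {J : Type u} (M : J → ZigzagModule.{v} k fwd) : ZigzagModule k fwd where
  V := fun i => ⨁ j, (M j).V i
  forward := fun i h => DirectSum.lmap fun j => (M j).forward i h
  backward := fun i h => DirectSum.lmap fun j => (M j).backward i h

/-- The `i`-th space of the interval module `I[b,d]`: `ℝ` for `b ≤ i ≤ d`, and `0` otherwise. -/
def intervalSpace (I : ℕ × ℕ) (i : ℕ) : Submodule ℝ ℝ :=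
  if I.1 ≤ i ∧ i ≤ I.2 then ⊤ else ⊥

open Classical in
/-- The map between two spaces of an interval module: the identity of `ℝ` if both spaces are `ℝ`,
and zero otherwise. -/
def intervalMap (I : ℕ × ℕ) (i j : ℕ) : intervalSpace I i →ₗ[ℝ] intervalSpace I j :=
  if h : intervalSpace I i ≤ intervalSpace I j then Submodule.inclusion h else 0

/-- The interval module `I[b,d]` of a given shape, for `I = (b,d)`. -/
def interval (fwd : Fin k → Prop) (I : ℕ × ℕ) : ZigzagModule.{0} k fwd where
  V := fun i => intervalSpace I i
  forward := fun i _ => intervalMap I (i.castSucc : Fin (k + 1)) (i.succ : Fin (k + 1))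
  backward := fun i _ => intervalMap I (i.succ : Fin (k + 1)) (i.castSucc : Fin (k + 1))

/-- `M` decomposes into the interval modules of the multiset `B` of (nonempty) integer intervals
`[b,d] ⊆ [0,k]`. -/
def DecomposesInto (M : ZigzagModule.{u} k fwd) (B : Multiset (ℕ × ℕ)) : Prop :=
  (∀ I ∈ B, I.1 ≤ I.2 ∧ I.2 ≤ k) ∧
    ∃ (J : Type) (_ : Fintype J) (I : J → ℕ × ℕ),
      Finset.univ.val.map I = B ∧ Nonempty (M.Iso (directSum fun j => interval fwd (I j)))

/-- `B` is the barcode of `M`: the multiset of intervals in a decomposition of `M` into interval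
modules, which is the same for every such decomposition. -/
def IsBarcode (M : ZigzagModule.{u} k fwd) (B : Multiset (ℕ × ℕ)) : Prop :=
  M.DecomposesInto B ∧ ∀ B', M.DecomposesInto B' → B' = B

/-- The zigzag module of a sequence of subspaces of a vector space, consecutive ones
being nested in one direction or the other, with the inclusions as arrows. -/
def ofNested {E : Type u} [AddCommGroup E] [Module ℝ E] (k : ℕ) (W : ℕ → Submodule ℝ E)
    (hW : ∀ i < k, W i ≤ W (i + 1) ∨ W (i + 1) ≤ W i) :
    ZigzagModule.{u} k (fun i : Fin k => W i ≤ W (i + 1)) where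
  V := fun i => W i
  forward := fun _ h => Submodule.inclusion h
  backward := fun i h => Submodule.inclusion ((hW i i.isLt).resolve_left h)

end ZigzagModule

namespace SimplexwiseFiltration

variable {V : Type u} [LinearOrder V] {m : ℕ} (F : SimplexwiseFiltration V m)

/-- The harmonic zigzag module `Har_p(F)` in degree `p`. -/
def harModule (p : ℕ) :
    ZigzagModule m (fun i : Fin m => har (F.K i) p ≤ har (F.K (i + 1)) p) :=
  ZigzagModule.ofNested m (fun i => har (F.K i) p) (F.har_nested_degree p)

/-- The harmonic zigzag module `Har(F)`, whose barcode is the harmonic chain barcode of `F`. -/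
def harTotalModule :
    ZigzagModule m (fun i : Fin m => harTotal (F.K i) ≤ harTotal (F.K (i + 1))) :=
  ZigzagModule.ofNested m (fun i => harTotal (F.K i)) F.harTotal_nested

/-- `z` is a partial harmonic `p`-representative for `[b,d] ⊆ [0,m]`: it is harmonic throughout
`[b,d]` and born at `b`. -/
def IsPartialRep (p b d : ℕ) (z : Chain V) : Prop :=
  0 < b ∧ b ≤ d ∧ d ≤ m ∧ (∀ i, b ≤ i → i ≤ d → z ∈ har (F.K i) p) ∧ z ∉ har (F.K (b - 1)) p

/-- `z` is a harmonic `p`-representative for `[b,d] ⊆ [0,m]`: a partial one that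
moreover dies leaving `d`. -/
def IsRep (p b d : ℕ) (z : Chain V) : Prop :=
  F.IsPartialRep p b d z ∧ (d < m → z ∉ har (F.K (d + 1)) p)

end SimplexwiseFiltration

/-! ### The incremental algorithm -/

/-- An output bar `[birth, death]` in degree `degree`, with the representative assigned to it. -/
structure Bar (V : Type u) where
  degree : ℕ
  birth : ℕ
  death : ℕ
  rep : Chain V

/-- The interval of a bar. -/
def Bar.interval {V : Type u} (B : Bar V) : ℕ × ℕ := (B.birth, B.death)

/-- A state of the algorithm. A pair `(p, b)` lies in `unpaired` if `b` belongs to the set `U^p` of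
unpaired birth indices in degree `p`; then `rep (p, b)` is the chain maintained for it. -/
structure AlgState (V : Type u) where
  unpaired : Finset (ℕ × ℕ)
  rep : ℕ × ℕ → Chain V
  output : Multiset (Bar V)

namespace AlgState

/-- At the start all sets `U^p` and the output are empty. -/
def initial (V : Type u) : AlgState V where
  unpaired := ∅
  rep := fun _ => 0
  output := 0

variable {V : Type u} [LinearOrder V] {m : ℕ} (F : SimplexwiseFiltration V m)

/-- The set `U'` of the births in `U^q` whose maintained representatives do not persist
to `K_{i+1}`. -/
def nonPersisting (i q : ℕ) (s : AlgState V) : Set ℕ :=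
  {b | (q, b) ∈ s.unpaired ∧ s.rep (q, b) ∉ har (F.K (i + 1)) q}

/-- The state after a positive `p`-simplex `σ_i`: the birth `i + 1` is added to `U^p` with the
representative `z`. -/
def addBirth (i p : ℕ) (z : Chain V) (s : AlgState V) : AlgState V where
  unpaired := insert (p, i + 1) s.unpaired
  rep := Function.update s.rep (p, i + 1) z
  output := s.output

open Classical in
/-- The state after a negative `(q+1)`-simplex `σ_i` whose death index `i` is paired
with the birth `bs`: the bar `[bs, i]` is output with its maintained representative `z_*`, `bs` is
removed from `U^q`, and for the other births in `U'` the representative `z` becomes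
`z - (α / α_*) z_*`, where `α = (δ z)(σ_i)` and `α_* = (δ z_*)(σ_i)`. -/
def pairDeath (i q bs : ℕ) (s : AlgState V) : AlgState V where
  unpaired := s.unpaired.erase (q, bs)
  rep := fun x =>
    if x.1 = q ∧ x.2 ∈ nonPersisting F i q s \ {bs} then
      s.rep x - (coboundary (s.rep x) (F.σ i) / coboundary (s.rep (q, bs)) (F.σ i)) • s.rep (q, bs)
    else s.rep x
  output := ⟨q, bs, i, s.rep (q, bs)⟩ ::ₘ s.output

/-- One iteration of the algorithm, which processes the insertion of `σ_i`. For a positive simplex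
the new harmonic cycle is any one that is not harmonic in `K_i`. -/
inductive Step (i : ℕ) (s : AlgState V) : AlgState V → Prop
  | positive (p : ℕ) (z : Chain V) (hdim : (F.σ i).card = p + 1) (hpos : F.Positive i)
      (hz : z ∈ har (F.K (i + 1)) p) (hz' : z ∉ har (F.K i) p) :
      Step i s (addBirth i p z s)
  | negative (q bs : ℕ) (hdim : (F.σ i).card = q + 2) (hneg : F.Negative i)
      (hbs : IsLeast (nonPersisting F i q s) bs) :
      Step i s (pairDeath F i q bs s)

/-- `Reaches F i s`: some run of the algorithm on `F` is in state `s` before iteration `i`, i.e.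
after `σ_0, …, σ_{i-1}` have been processed. -/
inductive Reaches : ℕ → AlgState V → Prop
  | start : Reaches 0 (initial V)
  | next {i : ℕ} {s s' : AlgState V} (hi : i < m) (hs : Reaches i s) (hstep : Step F i s s') :
      Reaches (i + 1) s'

/-- The final output: the bars found during the run, and a bar `[b, m]` with its maintained
representative for each birth that is still unpaired. -/
def finalBars (m : ℕ) (s : AlgState V) : Multiset (Bar V) :=
  s.output + s.unpaired.val.map fun x => ⟨x.1, x.2, m, s.rep x⟩

end AlgState

end HarmonicChain

end

noncomputable section

open scoped DirectSum

namespace HarmonicChain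

universe u

/-! ### The dot product of chains and orthogonal projections -/

/-! Each insertion adds or removes one dimension of harmonic chains, and in both cases the smaller
space is the kernel of an explicit functional on the larger one. If `∂σ` equals `∂c` with `c` in the
old complex, a cocycle `z` of the old complex satisfies `z(∂σ) = z(∂c) = 0`, so old harmonic chains
survive. They are the new ones with coefficient `0` at `σ`, and the harmonic part of the cycle `σ -
c` has coefficient `1` there (`birth_of_boundary_eq`). If `∂σ` does not bound, no new cycle uses
`σ`, so the surviving chains of the degree below are those with `z(∂σ) = 0`. The harmonic part `h`
of `∂σ` does not survive, because `h(∂σ) = h · h ≠ 0` (`death_of_notMem_boundaryGroup`).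

The algorithm preserves `AlgState.Invariant`: at every index reached so far, the current chains
whose bars contain that index form a basis of the harmonic group. A birth adjoins a vector off a
hyperplane. A death uses one vector off the hyperplane as a pivot to push the others into it. Taking
the oldest pivot matters twice: wherever a modified chain is alive, so is the pivot, hence all
earlier bases remain bases; and the pivot is already harmonic just before the modified chain is
born, hence births do not move.

A family that restricts to a basis at every index and has the right endpoints (`IsAdapted`) is an
interval decomposition. Conversely every interval decomposition of nested subspaces yields such a
family (`exists_isAdapted`). For such a family, the dimension of the intersection of the spaces over
`[a,b]` counts the bars containing `[a,b]` (`IsAdapted.finrank_iInf`). These counts depend only on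
the subspaces and determine the multiset of bars, which gives uniqueness. -/

/-- Anisotropy makes the map from `B` to its dual injective, hence bijective by dimension. The
ambient space may be infinite-dimensional, and symmetry of the form plays no role. -/
theorem exists_mem_form_sub_eq_zero {E : Type*} [AddCommGroup E] [Module ℝ E]
    (φ : E →ₗ[ℝ] E →ₗ[ℝ] ℝ) (hφ : ∀ z, φ z z = 0 → z = 0) (B : Submodule ℝ E)
    [FiniteDimensional ℝ B] (w : E) : ∃ b ∈ B, ∀ y ∈ B, φ (w - b) y = 0 := by
  let f : B →ₗ[ℝ] Module.Dual ℝ B := (φ.compl₂ B.subtype).comp B.subtype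
  have hinj : Function.Injective f := by
    rw [← LinearMap.ker_eq_bot, LinearMap.ker_eq_bot']
    intro b hb
    have h : φ (b : E) b = 0 := congrArg (fun g : Module.Dual ℝ B => g b) hb
    exact Subtype.ext (hφ _ h)
  have hsurj : Function.Surjective f :=
    (LinearMap.injective_iff_surjective_of_finrank_eq_finrank Subspace.dual_finrank_eq.symm).1 hinj
  obtain ⟨b, hb⟩ := hsurj ((φ w).comp B.subtype)
  refine ⟨b, b.2, fun y hy => ?_⟩
  have h : φ (b : E) y = φ w y := congrArg (fun g : Module.Dual ℝ B => g ⟨y, hy⟩) hb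
  rw [map_sub, LinearMap.sub_apply, h, sub_self]

section Chains

variable {V : Type u}

theorem mem_chainGroup {K : PreAbstractSimplicialComplex V} {p : ℕ} {z : Chain V} :
    z ∈ chainGroup K p ↔ ∀ s, z s ≠ 0 → s ∈ K ∧ s.card = p + 1 := by
  unfold chainGroup
  rw [Finsupp.mem_supported]
  exact forall_congr' fun s => by simp

theorem face_mem {K : PreAbstractSimplicialComplex V} {τ t : Finset V} (hτ : τ ∈ K) (h : t ⊆ τ) (ht : t.Nonempty) : t ∈ K :=
  (K.isRelLowerSet_faces hτ).2 h ht

/-- The dot product of chains for which the simplices form an orthonormal basis. -/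
def dot : Chain V →ₗ[ℝ] Chain V →ₗ[ℝ] ℝ :=
  LinearMap.mk₂ ℝ (fun z y => Finsupp.linearCombination ℝ (fun s => z s) y)
    (fun z w y => by
      simp [Finsupp.linearCombination_apply, Finsupp.sum, mul_add, Finset.sum_add_distrib])
    (fun a z y => by
      simp [Finsupp.linearCombination_apply, Finsupp.sum, Finset.mul_sum, mul_left_comm])
    (fun z y w => by simp) (fun a z y => by simp)

theorem dot_apply (z y : Chain V) : dot z y = ∑ s ∈ y.support, y s * z s := by
  simp [dot, Finsupp.linearCombination_apply, Finsupp.sum]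

theorem dot_self_eq_zero {z : Chain V} : dot z z = 0 ↔ z = 0 := by
  refine ⟨fun h => ?_, fun h => by simp [h]⟩
  rw [dot_apply, Finset.sum_eq_zero_iff_of_nonneg fun s _ => mul_self_nonneg _] at h
  ext s
  by_contra hs
  exact hs (mul_self_eq_zero.1 (h s (Finsupp.mem_support_iff.2 hs)))

theorem exists_mem_dot_sub_eq_zero (B : Submodule ℝ (Chain V)) [FiniteDimensional ℝ B]
    (w : Chain V) : ∃ b ∈ B, ∀ y ∈ B, dot (w - b) y = 0 :=
  exists_mem_form_sub_eq_zero dot (fun _ => dot_self_eq_zero.1) B w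

end Chains

section Boundary

variable {V : Type u} [LinearOrder V]

/-! ### The boundary of a boundary -/

theorem coboundary_eq_dot (z : Chain V) (τ : Finset V) :
    coboundary z τ = dot z (simplexBoundary τ) := rfl

@[simp]
theorem boundary_single (s : Finset V) (a : ℝ) :
    boundary (Finsupp.single s a) = a • simplexBoundary s := by
  simp [boundary]

theorem mem_of_simplexBoundary_ne_zero {s t : Finset V} (h : simplexBoundary s t ≠ 0) :
    t ⊆ s ∧ t.card + 1 = s.card ∧ t.Nonempty := by
  unfold simplexBoundary at h
  split_ifs at h with hs
  · rw [Finsupp.finsetSum_apply] at h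
    obtain ⟨v, hv, hne⟩ := Finset.exists_ne_zero_of_sum_ne_zero h
    rw [Finsupp.single_apply] at hne
    split_ifs at hne with ht
    · subst ht
      have := Finset.card_erase_add_one hv
      exact ⟨Finset.erase_subset _ _, this, Finset.card_pos.1 (by omega)⟩
    · exact absurd rfl hne
  · exact absurd rfl h

theorem filter_erase_lt_card_of_lt {s : Finset V} {v w : V} (hv : v ∈ s) (h : v < w) :
    ((s.erase v).filter (fun x => x < w)).card + 1 = (s.filter (fun x => x < w)).card := by
  rw [Finset.filter_erase]
  exact Finset.card_erase_add_one (Finset.mem_filter.2 ⟨hv, h⟩)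

theorem filter_erase_lt_card_of_gt {s : Finset V} {v w : V} (h : w < v) :
    ((s.erase v).filter (fun x => x < w)).card = (s.filter (fun x => x < w)).card := by
  rw [Finset.filter_erase, Finset.erase_eq_of_notMem]
  simp [h.le]

theorem boundary_simplexBoundary (s : Finset V) : boundary (simplexBoundary s) = 0 := by
  -- Edges are excluded from the double sum: homology is unreduced, so their facets have boundary
  -- zero by convention rather than by cancellation.
  by_cases h3 : 3 ≤ s.card
  · have hexp : boundary (simplexBoundary s) = ∑ x ∈ s.sigma fun v => s.erase v,
        Finsupp.single ((s.erase x.1).erase x.2)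
          ((-1 : ℝ) ^ (s.filter (fun w => w < x.1)).card *
            (-1 : ℝ) ^ ((s.erase x.1).filter (fun w => w < x.2)).card) := by
      rw [Finset.sum_sigma, simplexBoundary, if_pos (by omega), map_sum]
      refine Finset.sum_congr rfl fun v hv => ?_
      have hc := Finset.card_erase_add_one hv
      rw [boundary_single, simplexBoundary, if_pos (by omega), Finset.smul_sum]
      exact Finset.sum_congr rfl fun w _ => by rw [Finsupp.smul_single, smul_eq_mul]
    rw [hexp]
    -- Removing two vertices in the other order gives the same face. Only the position of the larger
    -- vertex drops by one when the smaller is removed first, so the signs are opposite.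
    refine Finset.sum_involution (fun x _ => ⟨x.2, x.1⟩) ?_ ?_ ?_ ?_
    · rintro ⟨v, w⟩ hx
      simp only [Finset.mem_sigma, Finset.mem_erase] at hx
      obtain ⟨hv, hwv, hw⟩ := hx
      dsimp only
      rw [Finset.erase_right_comm, ← Finsupp.single_add, Finsupp.single_eq_zero]
      rcases lt_or_gt_of_ne hwv with h | h
      · rw [filter_erase_lt_card_of_gt h, ← filter_erase_lt_card_of_lt hw h]
        ring
      · rw [filter_erase_lt_card_of_gt h, ← filter_erase_lt_card_of_lt hv h]
        ring
    · rintro ⟨v, w⟩ hx _ heq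
      simp only [Finset.mem_sigma, Finset.mem_erase] at hx
      exact hx.2.1 (congrArg Sigma.fst heq)
    · rintro ⟨v, w⟩ hx
      simp only [Finset.mem_sigma, Finset.mem_erase] at hx ⊢
      exact ⟨hx.2.2, hx.2.1.symm, hx.1⟩
    · rintro ⟨v, w⟩ _
      rfl
  · unfold simplexBoundary
    split_ifs with h2
    · rw [map_sum]
      refine Finset.sum_eq_zero fun v hv => ?_
      have hc := Finset.card_erase_add_one hv
      rw [boundary_single, simplexBoundary, if_neg (by omega), smul_zero]
    · exact map_zero _

/-! ### Chain groups and harmonic chains of a complex -/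

variable {K : PreAbstractSimplicialComplex V}

theorem mem_har {p : ℕ} {z : Chain V} :
    z ∈ har K p ↔ z ∈ chainGroup K p ∧ boundary z = 0 ∧
      ∀ τ ∈ K, τ.card = p + 2 → coboundary z τ = 0 :=
  ⟨fun h => ⟨h.1.1, h.1.2, h.2.2⟩, fun h => ⟨⟨h.1, h.2.1⟩, h.1, h.2.2⟩⟩

theorem simplexBoundary_mem_chainGroup {q : ℕ} {τ : Finset V} (hc : τ.card = q + 2)
    (hf : ∀ t ⊂ τ, t.Nonempty → t ∈ K) : simplexBoundary τ ∈ chainGroup K q := by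
  rw [mem_chainGroup]
  intro s hs
  obtain ⟨h1, h2, h3⟩ := mem_of_simplexBoundary_ne_zero hs
  refine ⟨hf s (h1.ssubset_of_ne ?_) h3, by omega⟩
  rintro rfl
  omega

theorem coboundary_eq_zero_of_card_ne {p : ℕ} {z : Chain V} {τ : Finset V}
    (hz : z ∈ chainGroup K p) (h : τ.card ≠ p + 2) : coboundary z τ = 0 := by
  rw [coboundary_eq_dot, dot_apply]
  refine Finset.sum_eq_zero fun s hs => ?_
  by_contra hne
  have h1 := (mem_of_simplexBoundary_ne_zero (Finsupp.mem_support_iff.1 hs)).2.1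
  have h2 := (mem_chainGroup.1 hz s (right_ne_zero_of_mul hne)).2
  omega

/-- The boundary group `B_q(K)`. -/
def boundaryGroup (K : PreAbstractSimplicialComplex V) (q : ℕ) : Submodule ℝ (Chain V) :=
  Submodule.span ℝ (simplexBoundary '' {τ | τ ∈ K ∧ τ.card = q + 2})

theorem finiteDimensional_boundaryGroup (hK : K.faces.Finite) (q : ℕ) :
    FiniteDimensional ℝ (boundaryGroup K q) :=
  FiniteDimensional.span_of_finite ℝ ((hK.subset fun _ h => h.1).image _)

theorem boundaryGroup_le (q : ℕ) : boundaryGroup K q ≤ cycleGroup K q := by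
  refine Submodule.span_le.2 ?_
  rintro _ ⟨τ, ⟨hτ, hc⟩, rfl⟩
  exact ⟨simplexBoundary_mem_chainGroup hc fun t ht hn => face_mem hτ ht.1 hn,
    boundary_simplexBoundary τ⟩

/-- Every cycle is the sum of a harmonic chain and a boundary. -/
theorem exists_har_add_boundary (hK : K.faces.Finite) {q : ℕ} {w : Chain V}
    (hw : w ∈ cycleGroup K q) :
    ∃ b ∈ boundaryGroup K q, w - b ∈ har K q ∧ ∀ y ∈ boundaryGroup K q, dot (w - b) y = 0 := by
  have := finiteDimensional_boundaryGroup hK q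
  obtain ⟨b, hb, hort⟩ := exists_mem_dot_sub_eq_zero (boundaryGroup K q) w
  have hcyc := Submodule.sub_mem _ hw (boundaryGroup_le q hb)
  -- The cocycle condition at `τ` is orthogonality to `∂τ`, one of the generators of the boundary
  -- group.
  exact ⟨b, hb, mem_har.2 ⟨hcyc.1, hcyc.2, fun τ hτ hc =>
    hort _ (Submodule.subset_span ⟨τ, ⟨hτ, hc⟩, rfl⟩)⟩, hort⟩

theorem finiteDimensional_harTotal (hK : K.faces.Finite) :
    FiniteDimensional ℝ (harTotal K) := by
  have hle : harTotal K ≤ Finsupp.supported ℝ ℝ K.faces :=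
    iSup_le fun p => (inf_le_left.trans inf_le_left).trans (Finsupp.supported_mono fun s hs => hs.1)
  have := hK.to_subtype
  have : FiniteDimensional ℝ (Finsupp.supported ℝ ℝ K.faces) :=
    LinearEquiv.finiteDimensional (Finsupp.supportedEquivFinsupp K.faces).symm
  exact Submodule.finiteDimensional_of_le hle

theorem finrank_sup_span_singleton_of_notMem {E : Type*} [AddCommGroup E] [Module ℝ E]
    {W : Submodule ℝ E} [FiniteDimensional ℝ W] {h : E} (hh : h ∉ W) :
    Module.finrank ℝ ↥(W ⊔ Submodule.span ℝ {h}) = Module.finrank ℝ W + 1 := by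
  have h0 : h ≠ 0 := fun h0 => hh (h0 ▸ W.zero_mem)
  have hd : W ⊓ Submodule.span ℝ {h} = ⊥ := by
    rw [← disjoint_iff, Submodule.disjoint_span_singleton' h0]
    exact hh
  have := Submodule.finrank_sup_add_finrank_inf_eq W (Submodule.span ℝ {h})
  rwa [hd, finrank_bot, add_zero, finrank_span_singleton h0] at this

end Boundary

/-! ### The harmonic chains before and after the insertion of a simplex -/

/-- The functional vanishes on the whole sum of the smaller spaces, so `h` is new; subtracting a
multiple of `h` moves any vector of the larger space in degree `p` into the smaller one. It serves
births as stated, and deaths with the two complexes exchanged. -/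
theorem finrank_iSup_eq_add_one {E : Type*} [AddCommGroup E] [Module ℝ E]
    {W W' : ℕ → Submodule ℝ E} [FiniteDimensional ℝ ↥(⨆ r, W r)] {p : ℕ} {φ : E →ₗ[ℝ] ℝ} {h : E}
    (hW : ∀ r, r ≠ p → W' r = W r) (hp : ∀ z, z ∈ W p ↔ z ∈ W' p ∧ φ z = 0) (hh : h ∈ W' p)
    (hφ : φ h ≠ 0) (hker : ∀ r, r ≠ p → W r ≤ LinearMap.ker φ) :
    Module.finrank ℝ ↥(⨆ r, W' r) = Module.finrank ℝ ↥(⨆ r, W r) + 1 := by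
  have hle : (⨆ r, W r) ≤ LinearMap.ker φ := iSup_le fun r => by
    by_cases hr : r = p
    · subst hr
      exact fun z hz => ((hp z).1 hz).2
    · exact hker r hr
  rw [← finrank_sup_span_singleton_of_notMem (h := h) fun hmem => hφ (hle hmem)]
  suffices h' : (⨆ r, W' r) = (⨆ r, W r) ⊔ Submodule.span ℝ {h} by rw [h']
  refine le_antisymm (iSup_le fun r => ?_) (sup_le (iSup_mono fun r => ?_) ?_)
  · by_cases hr : r = p
    · subst hr
      intro y hy
      have hmem : y - (φ y / φ h) • h ∈ W r :=
        (hp _).2 ⟨Submodule.sub_mem _ hy (Submodule.smul_mem _ _ hh), by simp [hφ]⟩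
      rw [← sub_add_cancel y ((φ y / φ h) • h)]
      exact Submodule.add_mem_sup (Submodule.mem_iSup_of_mem r hmem)
        (Submodule.smul_mem _ _ (Submodule.mem_span_singleton_self h))
    · rw [hW r hr]
      exact le_sup_of_le_left (le_iSup W r)
  · by_cases hr : r = p
    · subst hr
      exact fun z hz => ((hp z).1 hz).1
    · exact (hW r hr).ge
  · rw [Submodule.span_singleton_le_iff_mem]
    exact Submodule.mem_iSup_of_mem p hh

namespace SimplexwiseFiltration

variable {V : Type u} {m : ℕ} (F : SimplexwiseFiltration V m)

theorem finite_faces : ∀ i ≤ m, (F.K i).faces.Finite := by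
  intro i
  induction i with
  | zero =>
    intro _
    rw [F.K_zero]
    exact Set.finite_empty
  | succ i ih =>
    intro hi
    rw [F.step i hi]
    exact (ih (by omega)).insert _

variable {F} {i : ℕ}

theorem σ_mem (hi : i < m) : F.σ i ∈ F.K (i + 1) := (F.mem_succ_iff hi _).2 (Or.inl rfl)

theorem mem_succ_of_mem (hi : i < m) {s : Finset V} (h : s ∈ F.K i) : s ∈ F.K (i + 1) :=
  (F.mem_succ_iff hi s).2 (Or.inr h)

theorem mem_of_ssubset (hi : i < m) {t : Finset V} (h : t ⊂ F.σ i) (ht : t.Nonempty) : t ∈ F.K i :=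
  ((F.mem_succ_iff hi t).1 (face_mem (σ_mem hi) h.1 ht)).resolve_left h.ne

theorem σ_nonempty (hi : i < m) : (F.σ i).Nonempty :=
  ((F.K (i + 1)).isRelLowerSet_faces (σ_mem hi)).1

theorem chainGroup_le_succ (hi : i < m) (p : ℕ) : chainGroup (F.K i) p ≤ chainGroup (F.K (i + 1)) p :=
  Finsupp.supported_mono fun _ hs => ⟨mem_succ_of_mem hi hs.1, hs.2⟩

theorem mem_chainGroup_iff_succ (hi : i < m) {p : ℕ} {z : Chain V} :
    z ∈ chainGroup (F.K i) p ↔ z ∈ chainGroup (F.K (i + 1)) p ∧ z (F.σ i) = 0 := by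
  constructor
  · refine fun h => ⟨chainGroup_le_succ hi p h, ?_⟩
    by_contra hne
    exact F.notMem i hi (mem_chainGroup.1 h _ hne).1
  · rintro ⟨h, h0⟩
    refine mem_chainGroup.2 fun s hs => ?_
    obtain ⟨h1, h2⟩ := mem_chainGroup.1 h s hs
    refine ⟨((F.mem_succ_iff hi s).1 h1).resolve_left ?_, h2⟩
    rintro rfl
    exact hs h0

variable [LinearOrder V]

theorem mem_har_of_mem_succ (hi : i < m) {r : ℕ} {z : Chain V} (hz : z ∈ har (F.K (i + 1)) r)
    (h0 : z (F.σ i) = 0) : z ∈ har (F.K i) r := by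
  obtain ⟨h1, h2, h3⟩ := mem_har.1 hz
  exact mem_har.2 ⟨(mem_chainGroup_iff_succ hi).2 ⟨h1, h0⟩, h2,
    fun τ hτ => h3 τ (mem_succ_of_mem hi hτ)⟩

theorem mem_har_succ_of_mem (hi : i < m) {r : ℕ} {z : Chain V} (hz : z ∈ har (F.K i) r)
    (h0 : coboundary z (F.σ i) = 0) : z ∈ har (F.K (i + 1)) r := by
  obtain ⟨h1, h2, h3⟩ := mem_har.1 hz
  refine mem_har.2 ⟨chainGroup_le_succ hi r h1, h2, fun τ hτ hc => ?_⟩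
  rcases (F.mem_succ_iff hi τ).1 hτ with rfl | hτ
  · exact h0
  · exact h3 τ hτ hc

/-- A simplex whose boundary bounds adds a harmonic chain in its own degree. -/
theorem birth_of_boundary_eq (hi : i < m) {p : ℕ} (hp : (F.σ i).card = p + 1) {c : Chain V}
    (hc : c ∈ chainGroup (F.K i) p) (hb : boundary c = simplexBoundary (F.σ i)) :
    F.Positive i ∧ (∀ r, r ≠ p → har (F.K (i + 1)) r = har (F.K i) r) ∧
      (∀ z, z ∈ har (F.K i) p ↔ z ∈ har (F.K (i + 1)) p ∧ z (F.σ i) = 0) ∧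
      ∃ h ∈ har (F.K (i + 1)) p, h (F.σ i) ≠ 0 := by
  -- Expand `z(∂c)` over the simplices of `c`: each term vanishes by the cocycle condition, or for
  -- reasons of degree.
  have hcob : ∀ r, ∀ z ∈ har (F.K i) r, coboundary z (F.σ i) = 0 := by
    intro r z hz
    obtain ⟨h1, -, h3⟩ := mem_har.1 hz
    rw [coboundary_eq_dot, ← hb, boundary, Finsupp.linearCombination_apply, Finsupp.sum, map_sum]
    refine Finset.sum_eq_zero fun τ hτ => ?_
    rw [map_smul, ← coboundary_eq_dot]
    by_cases hcard : τ.card = r + 2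
    · rw [h3 τ (mem_chainGroup.1 hc τ (Finsupp.mem_support_iff.1 hτ)).1 hcard, smul_zero]
    · rw [coboundary_eq_zero_of_card_ne h1 hcard, smul_zero]
  have hne : ∀ r, r ≠ p → ∀ z ∈ har (F.K (i + 1)) r, z (F.σ i) = 0 := by
    intro r hr z hz
    by_contra h
    have := (mem_chainGroup.1 (mem_har.1 hz).1 _ h).2
    omega
  have hother : ∀ r, r ≠ p → har (F.K (i + 1)) r = har (F.K i) r := fun r hr =>
    le_antisymm (fun z hz => mem_har_of_mem_succ hi hz (hne r hr z hz))
      (fun z hz => mem_har_succ_of_mem hi hz (hcob r z hz))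
  have hsame : ∀ z, z ∈ har (F.K i) p ↔ z ∈ har (F.K (i + 1)) p ∧ z (F.σ i) = 0 := fun z =>
    ⟨fun hz => ⟨mem_har_succ_of_mem hi hz (hcob p z hz),
      ((mem_chainGroup_iff_succ hi).1 (mem_har.1 hz).1).2⟩, fun hz => mem_har_of_mem_succ hi hz.1 hz.2⟩
  have hcyc : Finsupp.single (F.σ i) 1 - c ∈ cycleGroup (F.K (i + 1)) p := by
    refine ⟨Submodule.sub_mem _ (mem_chainGroup.2 fun s hs => ?_) (chainGroup_le_succ hi p hc), ?_⟩
    · rw [Finsupp.single_apply] at hs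
      split_ifs at hs with h
      · subst h
        exact ⟨σ_mem hi, hp⟩
      · exact absurd rfl hs
    · change boundary (Finsupp.single (F.σ i) 1 - c) = 0
      rw [map_sub, boundary_single, one_smul, hb, sub_self]
  obtain ⟨b, hbB, hhar, -⟩ := exists_har_add_boundary (F.finite_faces (i + 1) hi) hcyc
  -- The new simplex is maximal, so no boundary contains it. Projecting `σ - c` along boundaries
  -- therefore keeps its coefficient `1`.
  have hle : boundaryGroup (F.K (i + 1)) p ≤ LinearMap.ker (Finsupp.lapply (R := ℝ) (F.σ i)) := by
    refine Submodule.span_le.2 ?_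
    rintro _ ⟨τ, ⟨hτ, hcard⟩, rfl⟩
    change simplexBoundary τ (F.σ i) = 0
    by_contra hne
    obtain ⟨h1, h2, -⟩ := mem_of_simplexBoundary_ne_zero hne
    rcases (F.mem_succ_iff hi τ).1 hτ with rfl | hτ
    · omega
    · exact F.notMem i hi (face_mem hτ h1 (σ_nonempty hi))
  have hσ : (Finsupp.single (F.σ i) 1 - c - b : Chain V) (F.σ i) ≠ 0 := by
    have h1 : b (F.σ i) = 0 := hle hbB
    rw [Finsupp.sub_apply, Finsupp.sub_apply, Finsupp.single_eq_same, h1,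
      ((mem_chainGroup_iff_succ hi).1 hc).2]
    norm_num
  refine ⟨?_, hother, hsame, _, hhar, hσ⟩
  have : FiniteDimensional ℝ ↥(⨆ r, har (F.K i) r) :=
    finiteDimensional_harTotal (F.finite_faces i hi.le)
  exact finrank_iSup_eq_add_one (φ := Finsupp.lapply (F.σ i)) hother hsame hhar hσ
    fun r hr z hz => hne r hr z (hother r hr ▸ hz)

/-- A simplex whose boundary does not bound removes a harmonic chain in the degree below. -/
theorem death_of_notMem_boundaryGroup (hi : i < m) {q : ℕ} (hq : (F.σ i).card = q + 2)
    (hb : simplexBoundary (F.σ i) ∉ boundaryGroup (F.K i) q) :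
    F.Negative i ∧ (∀ r, r ≠ q → har (F.K i) r = har (F.K (i + 1)) r) ∧
      (∀ z, z ∈ har (F.K (i + 1)) q ↔ z ∈ har (F.K i) q ∧ coboundary z (F.σ i) = 0) ∧
      ∃ h ∈ har (F.K i) q, coboundary h (F.σ i) ≠ 0 := by
  have hcyc : simplexBoundary (F.σ i) ∈ cycleGroup (F.K i) q :=
    ⟨simplexBoundary_mem_chainGroup hq fun _ => mem_of_ssubset hi, boundary_simplexBoundary _⟩
  -- A cycle with nonzero coefficient at `σ` can be solved for `∂σ`, which would exhibit it as a
  -- boundary in the old complex.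
  have hzero : ∀ r, ∀ z ∈ har (F.K (i + 1)) r, z (F.σ i) = 0 := by
    intro r z hz
    obtain ⟨h1, h2, -⟩ := mem_har.1 hz
    by_contra hne
    obtain rfl : r = q + 1 := by
      have := (mem_chainGroup.1 h1 _ hne).2
      omega
    refine hb ?_
    rw [← Finsupp.single_add_erase (F.σ i) z, map_add, boundary_single] at h2
    have h3 : boundary (z.erase (F.σ i)) ∈ boundaryGroup (F.K i) q := by
      rw [boundaryGroup, Finsupp.mem_span_image_iff_linearCombination]
      refine ⟨z.erase (F.σ i), ?_, rfl⟩
      exact (mem_chainGroup_iff_succ (p := q + 1) hi).2 ⟨mem_chainGroup.2 fun s hs =>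
        mem_chainGroup.1 h1 s fun h0 => hs (by rw [Finsupp.erase_apply, h0, ite_self]),
        Finsupp.erase_same⟩
    have h4 := Submodule.smul_mem _ (-(z (F.σ i))⁻¹) h3
    rwa [eq_neg_of_add_eq_zero_right h2, smul_neg, neg_smul, neg_neg, smul_smul,
      inv_mul_cancel₀ hne, one_smul] at h4
  have hcob : ∀ r, r ≠ q → ∀ z ∈ har (F.K i) r, coboundary z (F.σ i) = 0 := fun r hr z hz =>
    coboundary_eq_zero_of_card_ne (mem_har.1 hz).1 (by omega)
  have hother : ∀ r, r ≠ q → har (F.K i) r = har (F.K (i + 1)) r := fun r hr =>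
    le_antisymm (fun z hz => mem_har_succ_of_mem hi hz (hcob r hr z hz))
      (fun z hz => mem_har_of_mem_succ hi hz (hzero r z hz))
  have hsame : ∀ z, z ∈ har (F.K (i + 1)) q ↔ z ∈ har (F.K i) q ∧ coboundary z (F.σ i) = 0 :=
    fun z => ⟨fun hz => ⟨mem_har_of_mem_succ hi hz (hzero q z hz),
      (mem_har.1 hz).2.2 _ (σ_mem hi) hq⟩, fun hz => mem_har_succ_of_mem hi hz.1 hz.2⟩
  obtain ⟨b, hbB, hhar, hort⟩ := exists_har_add_boundary (F.finite_faces i hi.le) hcyc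
  -- With `h = ∂σ - b` orthogonal to `b`, the value is `h · ∂σ = h · h`; were it zero, `∂σ = b`
  -- would bound.
  have hσ : coboundary (simplexBoundary (F.σ i) - b) (F.σ i) ≠ 0 := by
    intro h0
    rw [coboundary_eq_dot] at h0
    have h1 : dot (simplexBoundary (F.σ i) - b) (simplexBoundary (F.σ i) - b) = 0 := by
      rw [map_sub (dot (simplexBoundary (F.σ i) - b)), h0, hort b hbB, sub_zero]
    rw [dot_self_eq_zero, sub_eq_zero] at h1
    exact hb (h1 ▸ hbB)
  refine ⟨?_, hother, hsame, _, hhar, hσ⟩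
  have : FiniteDimensional ℝ ↥(⨆ r, har (F.K (i + 1)) r) :=
    finiteDimensional_harTotal (F.finite_faces (i + 1) hi)
  exact (finrank_iSup_eq_add_one (φ := dot.flip (simplexBoundary (F.σ i))) hother hsame hhar hσ
    fun r hr z hz => hcob r hr z (hother r hr ▸ hz)).symm

/-- The dichotomy is whether `∂σ` bounds in the old complex. A vertex always gives a birth, as its
boundary is zero. -/
theorem birth_or_death (hi : i < m) :
    (∃ p, (F.σ i).card = p + 1 ∧ F.Positive i ∧
      (∀ r, r ≠ p → har (F.K (i + 1)) r = har (F.K i) r) ∧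
      (∀ z, z ∈ har (F.K i) p ↔ z ∈ har (F.K (i + 1)) p ∧ z (F.σ i) = 0) ∧
      ∃ h ∈ har (F.K (i + 1)) p, h (F.σ i) ≠ 0) ∨
    (∃ q, (F.σ i).card = q + 2 ∧ F.Negative i ∧
      (∀ r, r ≠ q → har (F.K i) r = har (F.K (i + 1)) r) ∧
      (∀ z, z ∈ har (F.K (i + 1)) q ↔ z ∈ har (F.K i) q ∧ coboundary z (F.σ i) = 0) ∧
      ∃ h ∈ har (F.K i) q, coboundary h (F.σ i) ≠ 0) := by
  have hcard := Finset.card_pos.2 (σ_nonempty (F := F) hi)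
  by_cases h1 : (F.σ i).card = 1
  · refine Or.inl ⟨0, h1, birth_of_boundary_eq hi h1 (Submodule.zero_mem _) ?_⟩
    rw [map_zero, simplexBoundary, if_neg (by omega)]
  · obtain ⟨q, hq⟩ := Nat.exists_eq_add_of_le' (show 2 ≤ (F.σ i).card by omega)
    by_cases hb : simplexBoundary (F.σ i) ∈ boundaryGroup (F.K i) q
    · rw [boundaryGroup, Finsupp.mem_span_image_iff_linearCombination] at hb
      obtain ⟨c, hc, hcb⟩ := hb
      exact Or.inl ⟨q + 1, hq, birth_of_boundary_eq hi hq hc hcb⟩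
    · exact Or.inr ⟨q, hq, death_of_notMem_boundaryGroup hi hq hb⟩

theorem Positive.not_negative (h : F.Positive i) : ¬ F.Negative i := by
  unfold Positive at h
  unfold Negative
  omega

/-- The two alternatives change the dimension differently, so the sign of the simplex alone recovers
the structural description. -/
theorem Positive.birth (hi : i < m) {p : ℕ} (hp : (F.σ i).card = p + 1) (hpos : F.Positive i) :
    (∀ r, r ≠ p → har (F.K (i + 1)) r = har (F.K i) r) ∧
      (∀ z, z ∈ har (F.K i) p ↔ z ∈ har (F.K (i + 1)) p ∧ z (F.σ i) = 0) ∧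
      ∃ h ∈ har (F.K (i + 1)) p, h (F.σ i) ≠ 0 := by
  rcases birth_or_death (F := F) hi with ⟨p', hp', -, h⟩ | ⟨q, -, hneg, -⟩
  · obtain rfl : p' = p := by omega
    exact h
  · exact absurd hneg hpos.not_negative

theorem Negative.death (hi : i < m) {q : ℕ} (hq : (F.σ i).card = q + 2) (hneg : F.Negative i) :
    (∀ r, r ≠ q → har (F.K i) r = har (F.K (i + 1)) r) ∧
      (∀ z, z ∈ har (F.K (i + 1)) q ↔ z ∈ har (F.K i) q ∧ coboundary z (F.σ i) = 0) ∧
      ∃ h ∈ har (F.K i) q, coboundary h (F.σ i) ≠ 0 := by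
  rcases birth_or_death (F := F) hi with ⟨p, -, hpos, -⟩ | ⟨q', hq', -, h⟩
  · exact absurd hneg hpos.not_negative
  · obtain rfl : q' = q := by omega
    exact h

end SimplexwiseFiltration

/-! ### Interval decompositions of modules of nested subspaces -/

namespace ZigzagModule

theorem intervalSpace_of_mem {I : ℕ × ℕ} {i : ℕ} (h : I.1 ≤ i ∧ i ≤ I.2) :
    intervalSpace I i = ⊤ := if_pos h

theorem intervalSpace_of_notMem {I : ℕ × ℕ} {i : ℕ} (h : ¬(I.1 ≤ i ∧ i ≤ I.2)) :
    intervalSpace I i = ⊥ := if_neg h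

theorem eq_zero_of_notMem {I : ℕ × ℕ} {i : ℕ} (h : ¬(I.1 ≤ i ∧ i ≤ I.2))
    (a : intervalSpace I i) : a = 0 :=
  Subtype.ext ((Submodule.mem_bot ℝ).1 (intervalSpace_of_notMem h ▸ a.2))

theorem coe_intervalMap {I : ℕ × ℕ} {i j : ℕ} (h : intervalSpace I i ≤ intervalSpace I j)
    (a : intervalSpace I i) : (intervalMap I i j a : ℝ) = a := by
  rw [intervalMap, dif_pos h]
  rfl

/-- The generator of the `i`-th space of an interval module. -/
def intervalUnit (I : ℕ × ℕ) (i : ℕ) : intervalSpace I i :=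
  ⟨if I.1 ≤ i ∧ i ≤ I.2 then 1 else 0, by
    unfold intervalSpace
    split_ifs <;> simp⟩

theorem coe_intervalUnit {I : ℕ × ℕ} {i : ℕ} (h : I.1 ≤ i ∧ i ≤ I.2) :
    (intervalUnit I i : ℝ) = 1 := if_pos h

theorem eq_smul_intervalUnit {I : ℕ × ℕ} {i : ℕ} (a : intervalSpace I i) :
    a = (a : ℝ) • intervalUnit I i := by
  by_cases h : I.1 ≤ i ∧ i ≤ I.2
  · exact Subtype.ext (by simp [coe_intervalUnit h])
  · rw [eq_zero_of_notMem h a]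
    simp

theorem intervalMap_intervalUnit {I : ℕ × ℕ} {i j : ℕ} (hi : I.1 ≤ i ∧ i ≤ I.2)
    (hj : I.1 ≤ j ∧ j ≤ I.2) : intervalMap I i j (intervalUnit I i) = intervalUnit I j :=
  Subtype.ext (by
    rw [coe_intervalMap (by rw [intervalSpace_of_mem hj]; exact le_top), coe_intervalUnit hi,
      coe_intervalUnit hj])

variable {E : Type u} [AddCommGroup E] [Module ℝ E] {k : ℕ} {W : ℕ → Submodule ℝ E}
  {ι : Type} [Fintype ι] {I : ι → ℕ × ℕ}

/-- The indices of the intervals that contain `i`. -/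
def alive (I : ι → ℕ × ℕ) (i : ℕ) : Finset ι :=
  Finset.univ.filter fun x => (I x).1 ≤ i ∧ i ≤ (I x).2

theorem mem_alive {x : ι} {i : ℕ} : x ∈ alive I i ↔ (I x).1 ≤ i ∧ i ≤ (I x).2 := by
  simp [alive]

/-- A family of vectors with lifespans, such that the vectors alive at `i` form a basis of
the `i`-th subspace of a sequence. -/
structure IsAdapted (k : ℕ) (W : ℕ → Submodule ℝ E) (I : ι → ℕ × ℕ) (z : ι → E) : Prop where
  le : ∀ x, (I x).1 ≤ (I x).2 ∧ (I x).2 ≤ k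
  linearIndepOn : ∀ i ≤ k, LinearIndepOn ℝ z (alive I i : Set ι)
  span_image : ∀ i ≤ k, Submodule.span ℝ (z '' (alive I i : Set ι)) = W i
  birth : ∀ x, 0 < (I x).1 → z x ∉ W ((I x).1 - 1)
  death : ∀ x, (I x).2 < k → z x ∉ W ((I x).2 + 1)

/-- The map from the direct sum of the `i`-th spaces of interval modules that sends the
generators to given vectors. -/
def combination (I : ι → ℕ × ℕ) (z : ι → E) (i : ℕ) :
    (⨁ x, intervalSpace (I x) i) →ₗ[ℝ] E :=
  ∑ x, (LinearMap.toSpanSingleton ℝ E (z x)) ∘ₗ (intervalSpace (I x) i).subtype ∘ₗ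
    DirectSum.component ℝ ι (fun x => intervalSpace (I x) i) x

theorem combination_apply (z : ι → E) (i : ℕ) (v : ⨁ x, intervalSpace (I x) i) :
    combination I z i v = ∑ x, (v x : ℝ) • z x := by
  simp [combination, LinearMap.sum_apply, DirectSum.component, DFinsupp.lapply]

theorem combination_apply_alive (z : ι → E) (i : ℕ) (v : ⨁ x, intervalSpace (I x) i) :
    combination I z i v = ∑ x ∈ alive I i, (v x : ℝ) • z x := by
  rw [combination_apply]
  refine (Finset.sum_subset (Finset.subset_univ _) fun x _ hx => ?_).symm
  rw [eq_zero_of_notMem (fun h => hx (mem_alive.2 h)) (v x)]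
  simp

open Classical in
/-- The element of the direct sum with given coordinates at the intervals alive at `i`. -/
def ofCoordinates (I : ι → ℕ × ℕ) (i : ℕ) (f : ι → ℝ) : ⨁ x, intervalSpace (I x) i :=
  ∑ x, DirectSum.lof ℝ ι (fun x => intervalSpace (I x) i) x (f x • intervalUnit (I x) i)

theorem ofCoordinates_apply (i : ℕ) (f : ι → ℝ) {x : ι} (hx : x ∈ alive I i) :
    (ofCoordinates I i f x : ℝ) = f x := by
  classical
  have h : ofCoordinates I i f x = f x • intervalUnit (I x) i := by
    unfold ofCoordinates
    rw [DirectSum.sum_apply, Finset.sum_eq_single x]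
    · convert! DirectSum.of_eq_same x _
    · intro y _ hy
      convert! DirectSum.of_eq_of_ne y x _ hy.symm
    · simp
  rw [h]
  simp [coe_intervalUnit (mem_alive.1 hx)]

theorem combination_ofCoordinates (z : ι → E) (i : ℕ) (f : ι → ℝ) :
    combination I z i (ofCoordinates I i f) = ∑ x ∈ alive I i, f x • z x := by
  rw [combination_apply_alive]
  exact Finset.sum_congr rfl fun x hx => by rw [ofCoordinates_apply i f hx]

/-- When no bar alive at `i` is missing at `j`, every interval map is an inclusion and coordinates
are unchanged. -/
theorem combination_lmap (z : ι → E) {i j : ℕ} (hij : alive I i ⊆ alive I j)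
    (v : ⨁ x, intervalSpace (I x) i) :
    combination I z j (DirectSum.lmap (fun x => intervalMap (I x) i j) v) =
      combination I z i v := by
  rw [combination_apply, combination_apply]
  refine Finset.sum_congr rfl fun x _ => ?_
  rw [DirectSum.lmap_apply, coe_intervalMap]
  by_cases hx : (I x).1 ≤ i ∧ i ≤ (I x).2
  · rw [intervalSpace_of_mem (mem_alive.1 (hij (mem_alive.2 hx)))]
    exact le_top
  · rw [intervalSpace_of_notMem hx]
    exact bot_le

/-! ### From adapted families to interval decompositions. -/

namespace IsAdapted

variable {z : ι → E} (h : IsAdapted k W I z)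

include h

theorem mem {i : ℕ} (hi : i ≤ k) {x : ι} (hx : x ∈ alive I i) : z x ∈ W i := by
  rw [← h.span_image i hi]
  exact Submodule.subset_span ⟨x, hx, rfl⟩

theorem combination_injective {i : ℕ} (hi : i ≤ k) : Function.Injective (combination I z i) := by
  refine (injective_iff_map_eq_zero _).2 fun v hv => ?_
  rw [combination_apply_alive] at hv
  have h0 := linearIndepOn_finset_iff.1 (h.linearIndepOn i hi) (fun x => (v x : ℝ)) hv
  refine DFinsupp.ext fun x => ?_
  by_cases hx : x ∈ alive I i
  · exact Subtype.ext (h0 x hx)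
  · exact eq_zero_of_notMem (fun h => hx (mem_alive.2 h)) _

theorem range_combination {i : ℕ} (hi : i ≤ k) :
    LinearMap.range (combination I z i) = W i := by
  rw [← h.span_image i hi]
  refine le_antisymm ?_ fun y hy => ?_
  · rintro _ ⟨v, rfl⟩
    rw [combination_apply_alive]
    exact Submodule.sum_mem _ fun x hx =>
      Submodule.smul_mem _ _ (Submodule.subset_span ⟨x, hx, rfl⟩)
  · obtain ⟨f, rfl⟩ := (Submodule.mem_span_image_finset_iff_exists_fun' ℝ).1 hy
    exact ⟨_, combination_ofCoordinates z i f⟩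

/-- A bar ending at `i` would have its vector in the next space, against the death condition. The
birth condition plays the mirror role for backward arrows. -/
theorem alive_subset_succ {i : ℕ} (hi : i < k) (hle : W i ≤ W (i + 1)) :
    alive I i ⊆ alive I (i + 1) := by
  intro x hx
  have hmem := hle (h.mem hi.le hx)
  rw [mem_alive] at hx ⊢
  refine ⟨by omega, ?_⟩
  by_contra hne
  obtain rfl : i = (I x).2 := by omega
  exact h.death x hi hmem

theorem alive_succ_subset {i : ℕ} (hi : i < k) (hle : W (i + 1) ≤ W i) :
    alive I (i + 1) ⊆ alive I i := by
  intro x hx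
  have hmem := hle (h.mem hi hx)
  rw [mem_alive] at hx ⊢
  refine ⟨?_, by omega⟩
  by_contra hne
  obtain ⟨hx1, -⟩ := hx
  have hi' : i = (I x).1 - 1 := by omega
  exact h.birth x (by omega) (hi' ▸ hmem)

/-- The isomorphism from a direct sum of spaces of interval modules defined by an adapted family. -/
def combinationEquiv {i : ℕ} (hi : i ≤ k) : (⨁ x, intervalSpace (I x) i) ≃ₗ[ℝ] W i :=
  (LinearEquiv.ofInjective _ (h.combination_injective hi)).trans
    (LinearEquiv.ofEq _ _ (h.range_combination hi))

theorem combinationEquiv_symm_inclusion {i j : ℕ} (hi : i ≤ k) (hj : j ≤ k)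
    (hij : alive I i ⊆ alive I j) (hle : W i ≤ W j) (y : W i) :
    (h.combinationEquiv hj).symm (Submodule.inclusion hle y) =
      DirectSum.lmap (fun x => intervalMap (I x) i j) ((h.combinationEquiv hi).symm y) := by
  obtain ⟨v, rfl⟩ := (h.combinationEquiv hi).surjective y
  rw [LinearEquiv.symm_apply_eq, LinearEquiv.symm_apply_apply]
  exact Subtype.ext (combination_lmap z hij v).symm

/-- The interval decomposition of a module of nested subspaces defined by an adapted family. -/
def iso (hW : ∀ i < k, W i ≤ W (i + 1) ∨ W (i + 1) ≤ W i) :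
    (ofNested k W hW).Iso
      (directSum fun x => interval (fun i : Fin k => W i ≤ W (i + 1)) (I x)) where
  equiv i := (h.combinationEquiv (Nat.le_of_lt_succ i.isLt)).symm
  comm_forward i hi y :=
    h.combinationEquiv_symm_inclusion i.isLt.le i.isLt (h.alive_subset_succ i.isLt hi) hi y
  comm_backward i hi y :=
    have hle := (hW i i.isLt).resolve_left hi
    h.combinationEquiv_symm_inclusion i.isLt i.isLt.le (h.alive_succ_subset i.isLt hle) hle y

theorem decomposesInto (hW : ∀ i < k, W i ≤ W (i + 1) ∨ W (i + 1) ≤ W i) :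
    (ofNested k W hW).DecomposesInto (Finset.univ.val.map I) := by
  refine ⟨fun J hJ => ?_, ι, inferInstance, I, rfl, ⟨h.iso hW⟩⟩
  obtain ⟨x, -, rfl⟩ := Multiset.mem_map.1 hJ
  exact h.le x

/-! ### Uniqueness of interval decompositions -/

/-- The right end is moved one step at a time. Across an upward inclusion no bar ends; across a
downward one, two expansions in the same basis are compared. -/
theorem mem_span_of_forall_mem (hW : ∀ i < k, W i ≤ W (i + 1) ∨ W (i + 1) ≤ W i) {a b : ℕ}
    (hab : a ≤ b) (hb : b ≤ k) {y : E} (hy : ∀ i, a ≤ i → i ≤ b → y ∈ W i) :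
    y ∈ Submodule.span ℝ (z '' {x | (I x).1 ≤ a ∧ b ≤ (I x).2}) := by
  induction b, hab using Nat.le_induction with
  | base =>
    have := hy a le_rfl le_rfl
    rw [← h.span_image a hb] at this
    exact Submodule.span_mono (Set.image_mono fun x hx => mem_alive.1 (Finset.mem_coe.1 hx)) this
  | succ b hab ih =>
    have hspan := ih (by omega) fun i h1 h2 => hy i h1 (by omega)
    rcases hW b hb with hle | hle
    · have hsub : {x | (I x).1 ≤ a ∧ b ≤ (I x).2} ⊆ {x | (I x).1 ≤ a ∧ b + 1 ≤ (I x).2} :=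
        fun x hx => ⟨hx.1, (mem_alive.1
          (h.alive_subset_succ hb hle (mem_alive.2 ⟨hx.1.trans hab, hx.2⟩))).2⟩
      exact Submodule.span_mono (Set.image_mono hsub) hspan
    · have hsub := h.alive_succ_subset hb hle
      have hy' := hy (b + 1) (by omega) le_rfl
      rw [← h.span_image (b + 1) hb] at hy'
      have hind := h.linearIndepOn b (by omega)
      have hsub' : {x | (I x).1 ≤ a ∧ b ≤ (I x).2} ⊆ (alive I b : Set ι) := fun x hx =>
        Finset.mem_coe.2 (mem_alive.2 ⟨hx.1.trans hab, hx.2⟩)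
      rw [Finsupp.mem_span_image_iff_linearCombination] at hspan hy'
      obtain ⟨f, hf, hfy⟩ := hspan
      obtain ⟨g, hg, hgy⟩ := hy'
      -- Both expansions use vectors alive at `b`, which are independent. Hence the common support
      -- lies among the bars that contain `[a,b]` and also reach `b + 1`.
      have hfg : f = g := by
        rw [linearIndepOn_iff] at hind
        have hf' := Finsupp.supported_mono (M := ℝ) (R := ℝ) hsub' hf
        have hg' := Finsupp.supported_mono (M := ℝ) (R := ℝ) (Finset.coe_subset.2 hsub) hg
        exact sub_eq_zero.1 (hind _ (Submodule.sub_mem _ hf' hg') (by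
          rw [map_sub, hfy, hgy, sub_self]))
      subst hfg
      have hfs : (f.support : Set ι) ⊆ {x | (I x).1 ≤ a ∧ b + 1 ≤ (I x).2} := fun x hx =>
        ⟨(hf hx).1, (mem_alive.1 (Finset.mem_coe.1 (hg hx))).2⟩
      exact (Finsupp.mem_span_image_iff_linearCombination ℝ).2 ⟨f, hfs, hfy⟩

/-- The left side does not mention the family, so the count on the right is the same for every
adapted family of `W`. -/
theorem finrank_iInf (hW : ∀ i < k, W i ≤ W (i + 1) ∨ W (i + 1) ≤ W i) {a b : ℕ}
    (hab : a ≤ b) (hb : b ≤ k) :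
    Module.finrank ℝ ↥(⨅ i ∈ Set.Icc a b, W i) =
      (Finset.univ.val.map I).countP fun J => J.1 ≤ a ∧ b ≤ J.2 := by
  have heq : (⨅ i ∈ Set.Icc a b, W i) =
      Submodule.span ℝ (z '' {x | (I x).1 ≤ a ∧ b ≤ (I x).2}) := by
    refine le_antisymm (fun y hy => h.mem_span_of_forall_mem hW hab hb fun i h1 h2 => ?_)
      (le_iInf₂ fun i hi => ?_)
    · exact (Submodule.mem_iInf _).1 ((Submodule.mem_iInf _).1 hy i) ⟨h1, h2⟩
    · rw [← h.span_image i (hi.2.trans hb)]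
      exact Submodule.span_mono (Set.image_mono fun x hx =>
        Finset.mem_coe.2 (mem_alive.2 ⟨hx.1.trans hi.1, hi.2.trans hx.2⟩))
  have hind : LinearIndepOn ℝ z {x | (I x).1 ≤ a ∧ b ≤ (I x).2} :=
    (h.linearIndepOn b hb).mono fun x hx => Finset.mem_coe.2 (mem_alive.2 ⟨hx.1.trans hab, hx.2⟩)
  have hcard := finrank_span_eq_card hind
  rw [heq, Set.image_eq_range, hcard, Multiset.countP_map]
  rw [Fintype.card_subtype]
  rfl

end IsAdapted

/-- Inclusion–exclusion in the two endpoints. Strict inequalities on the left endpoint avoid `a -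
1`, which would be wrong at `a = 0`. -/
theorem count_add_countP (B : Multiset (ℕ × ℕ)) (a b : ℕ) :
    B.count (a, b) + (B.countP (fun J => J.1 < a ∧ b ≤ J.2) +
      B.countP fun J => J.1 < a + 1 ∧ b + 1 ≤ J.2) =
    B.countP (fun J => J.1 < a + 1 ∧ b ≤ J.2) + B.countP fun J => J.1 < a ∧ b + 1 ≤ J.2 := by
  induction B using Multiset.induction with
  | empty => simp
  | cons J B ih =>
    obtain ⟨c, d⟩ := J
    simp only [Multiset.count_cons, Multiset.countP_cons, Prod.mk.injEq]
    split_ifs <;> omega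

/-- A multiset of intervals is determined by the numbers of its members that contain a given
interval. -/
theorem eq_of_countP_eq {B B' : Multiset (ℕ × ℕ)} (hB : ∀ J ∈ B, J.1 ≤ J.2 ∧ J.2 ≤ k)
    (hB' : ∀ J ∈ B', J.1 ≤ J.2 ∧ J.2 ≤ k)
    (h : ∀ a b, a ≤ b → b ≤ k → B.countP (fun J => J.1 ≤ a ∧ b ≤ J.2) =
      B'.countP fun J => J.1 ≤ a ∧ b ≤ J.2) : B = B' := by
  -- The hypothesis in strict form, extended to the edge cases `a = 0` and `b = k + 1`, where both
  -- counts vanish.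
  have key : ∀ a b, a ≤ b + 1 → b ≤ k + 1 → B.countP (fun J => J.1 < a ∧ b ≤ J.2) =
      B'.countP fun J => J.1 < a ∧ b ≤ J.2 := by
    intro a b hab hb
    rcases Nat.eq_zero_or_pos a with rfl | ha
    · simp
    rcases Nat.lt_or_ge k b with hk | hk
    · rw [Multiset.countP_eq_zero.2, Multiset.countP_eq_zero.2]
      · rintro J hJ ⟨-, h2⟩
        have := (hB' J hJ).2
        omega
      · rintro J hJ ⟨-, h2⟩
        have := (hB J hJ).2
        omega
    · obtain ⟨a, rfl⟩ := Nat.exists_eq_add_of_le' ha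
      simpa only [Nat.lt_succ_iff] using h a b (by omega) hk
  ext ⟨a, b⟩
  by_cases hab : a ≤ b ∧ b ≤ k
  · have h1 := count_add_countP B a b
    have h2 := count_add_countP B' a b
    have k1 := key a b (by omega) (by omega)
    have k2 := key (a + 1) (b + 1) (by omega) (by omega)
    have k3 := key (a + 1) b (by omega) (by omega)
    have k4 := key a (b + 1) (by omega) (by omega)
    omega
  · rw [Multiset.count_eq_zero_of_notMem fun hJ => hab (hB _ hJ),
      Multiset.count_eq_zero_of_notMem fun hJ => hab (hB' _ hJ)]

/-- The generator of each interval summand is carried into `E`. As all arrows are inclusions, its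
image is one fixed vector along the interval. -/
theorem exists_isAdapted (hW : ∀ i < k, W i ≤ W (i + 1) ∨ W (i + 1) ≤ W i)
    (hI : ∀ x, (I x).1 ≤ (I x).2 ∧ (I x).2 ≤ k)
    (e : (ofNested k W hW).Iso
      (directSum fun x => interval (fun i : Fin k => W i ≤ W (i + 1)) (I x))) :
    ∃ z, IsAdapted k W I z := by
  classical
  -- The inverse isomorphisms with values in `E`, indexed by all naturals and zero beyond `k`;
  -- naturality becomes invariance under the interval maps.
  obtain ⟨g, hinj, hrange, hfwd, hbwd⟩ : ∃ g : ∀ i, (⨁ x, intervalSpace (I x) i) →ₗ[ℝ] E,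
      (∀ i ≤ k, Function.Injective (g i)) ∧ (∀ i ≤ k, LinearMap.range (g i) = W i) ∧
      (∀ i < k, W i ≤ W (i + 1) → ∀ v,
        g (i + 1) (DirectSum.lmap (fun x => intervalMap (I x) i (i + 1)) v) = g i v) ∧
      (∀ i < k, ¬ W i ≤ W (i + 1) → ∀ v,
        g i (DirectSum.lmap (fun x => intervalMap (I x) (i + 1) i) v) = g (i + 1) v) := by
    let e' : ∀ i : ℕ, i ≤ k → (W i ≃ₗ[ℝ] ⨁ x, intervalSpace (I x) i) :=
      fun i hi => e.equiv ⟨i, Nat.lt_succ_of_le hi⟩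
    let g : ∀ i, (⨁ x, intervalSpace (I x) i) →ₗ[ℝ] E := fun i =>
      if hi : i ≤ k then (W i).subtype ∘ₗ (e' i hi).symm.toLinearMap else 0
    have hg : ∀ i (hi : i ≤ k) v, g i v = ((e' i hi).symm v : E) := fun i hi v => by
      simp only [g, dif_pos hi]
      rfl
    refine ⟨g, fun i hi v w hvw => ?_, fun i hi => ?_, fun i hi hle v => ?_, fun i hi hle v => ?_⟩
    · rw [hg i hi, hg i hi] at hvw
      exact (e' i hi).symm.injective (Subtype.ext hvw)
    · ext y
      constructor
      · rintro ⟨v, rfl⟩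
        rw [hg i hi]
        exact ((e' i hi).symm v).2
      · intro hy
        exact ⟨e' i hi ⟨y, hy⟩, by rw [hg i hi, LinearEquiv.symm_apply_apply]⟩
    · rw [hg i hi.le, hg (i + 1) hi]
      obtain ⟨y, rfl⟩ := (e' i hi.le).surjective v
      have := e.comm_forward ⟨i, hi⟩ hle y
      have h2 : e' (i + 1) hi (Submodule.inclusion hle y) =
        DirectSum.lmap (fun x => intervalMap (I x) i (i + 1)) (e' i hi.le y) := this
      rw [← h2, LinearEquiv.symm_apply_apply, LinearEquiv.symm_apply_apply]
      rfl
    · rw [hg i hi.le, hg (i + 1) hi]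
      obtain ⟨y, rfl⟩ := (e' (i + 1) hi).surjective v
      have := e.comm_backward ⟨i, hi⟩ hle y
      have h2 : e' i hi.le (Submodule.inclusion ((hW i hi).resolve_left hle) y) =
        DirectSum.lmap (fun x => intervalMap (I x) (i + 1) i) (e' (i + 1) hi y) := this
      rw [← h2, LinearEquiv.symm_apply_apply, LinearEquiv.symm_apply_apply]
      rfl
  let gen : ∀ i (x : ι), ⨁ x, intervalSpace (I x) i := fun i x =>
    DirectSum.lof ℝ ι (fun x => intervalSpace (I x) i) x (intervalUnit (I x) i)
  have hlmap : ∀ i j x, (I x).1 ≤ i ∧ i ≤ (I x).2 → (I x).1 ≤ j ∧ j ≤ (I x).2 →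
      DirectSum.lmap (fun x => intervalMap (I x) i j) (gen i x) = gen j x := fun i j x hi hj => by
    simp only [gen]
    rw [DirectSum.lmap_lof, intervalMap_intervalUnit hi hj]
  have hlmap0 : ∀ i j x, ¬((I x).1 ≤ j ∧ j ≤ (I x).2) →
      DirectSum.lmap (fun x => intervalMap (I x) i j) (gen i x) = 0 := fun i j x hj => by
    simp only [gen]
    rw [DirectSum.lmap_lof, eq_zero_of_notMem hj (intervalMap _ _ _ _), map_zero]
  have hgen : ∀ i x, (I x).1 ≤ i ∧ i ≤ (I x).2 → ((gen i x) x : ℝ) = 1 := fun i x hi => by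
    rw [← coe_intervalUnit hi]
    congr 1
    exact DirectSum.lof_apply ℝ x _
  let z : ι → E := fun x => g (I x).1 (gen (I x).1 x)
  have hz : ∀ i x, (I x).1 ≤ i → i ≤ (I x).2 → g i (gen i x) = z x := by
    intro i x h1
    induction i, h1 using Nat.le_induction with
    | base => exact fun _ => rfl
    | succ i h1 ih =>
      intro h2
      have hik : i < k := by have := (hI x).2; omega
      rw [← ih (by omega)]
      by_cases hle : W i ≤ W (i + 1)
      · rw [← hfwd i hik hle, hlmap i (i + 1) x ⟨h1, by omega⟩ ⟨by omega, h2⟩]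
      · rw [← hbwd i hik hle, hlmap (i + 1) i x ⟨by omega, h2⟩ ⟨h1, by omega⟩]
  have hcomb : ∀ i v, g i v = combination I z i v := by
    intro i v
    have hv : v = ∑ x, (v x : ℝ) • gen i x := by
      conv_lhs => rw [← DirectSum.sum_univ_of v]
      refine Finset.sum_congr rfl fun x _ => ?_
      conv_lhs => rw [eq_smul_intervalUnit (v x)]
      exact map_smul (DirectSum.lof ℝ ι (fun x => intervalSpace (I x) i) x) _ _
    conv_lhs => rw [hv]
    rw [map_sum, combination_apply]
    refine Finset.sum_congr rfl fun x _ => ?_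
    rw [map_smul]
    by_cases hx : (I x).1 ≤ i ∧ i ≤ (I x).2
    · rw [hz i x hx.1 hx.2]
    · rw [eq_zero_of_notMem hx (v x)]
      simp
  -- a generator does not come from the outside of its interval
  have hout : ∀ i j x, (I x).1 ≤ i ∧ i ≤ (I x).2 → ¬((I x).1 ≤ j ∧ j ≤ (I x).2) → i ≤ k → j ≤ k →
      ((∀ v, g j (DirectSum.lmap (fun x => intervalMap (I x) i j) v) = g i v) ∨
        (∀ v, g i (DirectSum.lmap (fun x => intervalMap (I x) j i) v) = g j v)) →
      z x ∉ W j := by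
    intro i j x hi hj hik hjk hij hmem
    rcases hij with hij | hij
    -- A map from `i` to `j` kills the generator, contradicting injectivity at `i`.
    · have h0 := hij (gen i x)
      rw [hlmap0 i j x hj, map_zero] at h0
      have h1 := hgen i x hi
      rw [hinj i hik (h0.symm.trans (map_zero _).symm)] at h1
      simp at h1
    -- A map from `j` to `i` only produces elements with coordinate `0` at `x`, whereas the
    -- generator has coordinate `1`.
    · rw [← hrange j hjk] at hmem
      obtain ⟨v, hv⟩ := hmem
      rw [← hij, ← hz i x hi.1 hi.2] at hv
      have h1 := hgen i x hi
      rw [← hinj i hik hv, DirectSum.lmap_apply, eq_zero_of_notMem hj (v x)] at h1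
      simp at h1
  refine ⟨z, hI, fun i hi => ?_, fun i hi => ?_, fun x hx => ?_, fun x hx => ?_⟩
  · refine linearIndepOn_finset_iff.2 fun f hf x hx => ?_
    rw [← combination_ofCoordinates, ← hcomb] at hf
    rw [← ofCoordinates_apply i f hx, hinj i hi (hf.trans (map_zero _).symm)]
    rfl
  · rw [← hrange i hi]
    refine le_antisymm (Submodule.span_le.2 ?_) ?_
    · rintro _ ⟨x, hx, rfl⟩
      have hx := mem_alive.1 (Finset.mem_coe.1 hx)
      exact ⟨gen i x, hz i x hx.1 hx.2⟩
    · rintro _ ⟨v, rfl⟩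
      rw [hcomb, combination_apply_alive]
      exact Submodule.sum_mem _ fun x hx =>
        Submodule.smul_mem _ _ (Submodule.subset_span ⟨x, hx, rfl⟩)
  · obtain ⟨i, hi⟩ := Nat.exists_eq_add_of_le' hx
    have hle := hI x
    rw [hi, Nat.add_sub_cancel]
    refine hout (i + 1) i x (by omega) (by omega) (by omega) (by omega) ?_
    by_cases hW' : W i ≤ W (i + 1)
    · exact Or.inr (hfwd i (by omega) hW')
    · exact Or.inl (hbwd i (by omega) hW')
  · have hle := hI x
    refine hout (I x).2 ((I x).2 + 1) x (by omega) (by omega) (by omega) (by omega) ?_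
    by_cases hW' : W (I x).2 ≤ W ((I x).2 + 1)
    · exact Or.inl (hfwd _ (by omega) hW')
    · exact Or.inr (hbwd _ (by omega) hW')

theorem IsAdapted.isBarcode {z : ι → E} (h : IsAdapted k W I z)
    (hW : ∀ i < k, W i ≤ W (i + 1) ∨ W (i + 1) ≤ W i) :
    (ofNested k W hW).IsBarcode (Finset.univ.val.map I) := by
  refine ⟨h.decomposesInto hW, ?_⟩
  rintro _ ⟨hB, J, hJ, I', rfl, ⟨e⟩⟩
  obtain ⟨z', h'⟩ := exists_isAdapted hW
    (fun x => hB _ (Multiset.mem_map_of_mem _ (Finset.mem_univ x))) e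
  refine eq_of_countP_eq hB (h.decomposesInto hW).1 fun a b hab hb => ?_
  rw [← h.finrank_iInf hW hab hb, ← h'.finrank_iInf hW hab hb]

end ZigzagModule

/-! ### Changes of bases -/

/-- The members of a family with indices in `A` form a basis of the subspace `W`. -/
def IsBasisOn {E ι : Type*} [AddCommGroup E] [Module ℝ E] (z : ι → E) (A : Set ι)
    (W : Submodule ℝ E) : Prop :=
  LinearIndepOn ℝ z A ∧ Submodule.span ℝ (z '' A) = W

namespace IsBasisOn

variable {E ι : Type*} [AddCommGroup E] [Module ℝ E] {z z' : ι → E} {A : Set ι} {a : ι}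
  {W W' : Submodule ℝ E} {φ : E →ₗ[ℝ] ℝ}

theorem mem (h : IsBasisOn z A W) (ha : a ∈ A) : z a ∈ W :=
  h.2 ▸ Submodule.subset_span ⟨a, ha, rfl⟩

theorem congr (h : IsBasisOn z A W) (hz : Set.EqOn z z' A) : IsBasisOn z' A W :=
  ⟨(linearIndepOn_congr hz).1 h.1, by rw [← h.2, hz.image_eq]⟩

theorem exists_ne_zero (h : IsBasisOn z A W) {w : E} (hw : w ∈ W) (hφ : φ w ≠ 0) :
    ∃ x ∈ A, φ (z x) ≠ 0 := by
  by_contra! hall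
  refine hφ ?_
  have hle : Submodule.span ℝ (z '' A) ≤ LinearMap.ker φ := Submodule.span_le.2 (by
    rintro _ ⟨x, hx, rfl⟩
    exact hall x hx)
  exact hle (h.2 ▸ hw)

/-- `W` is a hyperplane of `W'`, and `z a` is off it. This is the birth step. -/
theorem insert (h : IsBasisOn z A W) (hW : ∀ y, y ∈ W ↔ y ∈ W' ∧ φ y = 0) (ha : z a ∈ W')
    (hφ : φ (z a) ≠ 0) : IsBasisOn z (insert a A) W' := by
  refine ⟨h.1.insert fun hmem => hφ ((hW _).1 (h.2 ▸ hmem)).2, ?_⟩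
  rw [Set.image_insert_eq, Submodule.span_insert, h.2]
  refine le_antisymm (sup_le ((Submodule.span_singleton_le_iff_mem _ _).2 ha)
    fun y hy => ((hW y).1 hy).1) fun y hy => ?_
  have hmem : y - (φ y / φ (z a)) • z a ∈ W :=
    (hW _).2 ⟨Submodule.sub_mem _ hy (Submodule.smul_mem _ _ ha), by simp [hφ]⟩
  rw [← add_sub_cancel ((φ y / φ (z a)) • z a) y]
  exact Submodule.add_mem_sup (Submodule.smul_mem _ _ (Submodule.mem_span_singleton_self _)) hmem

/-- An invertible column operation with pivot `a`. If the pivot is absent from `A`, then `hcA` says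
that nothing in `A` changes. -/
theorem sub_smul (h : IsBasisOn z A W) {c : ι → ℝ} (hca : c a = 0)
    (hcA : ∀ x ∈ A, c x ≠ 0 → a ∈ A) (hz' : ∀ x, z' x = z x - c x • z a) :
    IsBasisOn z' A W := by
  by_cases ha : a ∈ A
  · have hza : z' a = z a := by rw [hz', hca, zero_smul, sub_zero]
    constructor
    · rw [linearIndepOn_iff]
      intro l hl h0
      -- In terms of `z`, only the coefficient at `a` shifts. Independence then concentrates `l` at
      -- `a`, where `c a = 0` makes the shift itself vanish.
      have hcomb : Finsupp.linearCombination ℝ z' l = Finsupp.linearCombination ℝ z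
          (l - Finsupp.single a (Finsupp.linearCombination ℝ c l)) := by
        rw [map_sub, Finsupp.linearCombination_single]
        simp only [Finsupp.linearCombination_apply, Finsupp.sum, hz', smul_sub,
          Finset.sum_sub_distrib, Finset.sum_smul, smul_smul, smul_eq_mul]
      rw [hcomb] at h0
      have hl' := linearIndepOn_iff.1 h.1 _ (Submodule.sub_mem _ hl
        (Finsupp.single_mem_supported ℝ _ ha)) h0
      rw [sub_eq_zero] at hl'
      have hc0 : Finsupp.linearCombination ℝ c l = 0 := by
        rw [hl', Finsupp.linearCombination_single, hca, smul_zero]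
      rw [hl', hc0, Finsupp.single_zero]
    · rw [← h.2]
      refine le_antisymm (Submodule.span_le.2 ?_) (Submodule.span_le.2 ?_)
      · rintro _ ⟨x, hx, rfl⟩
        rw [hz']
        exact Submodule.sub_mem _ (Submodule.subset_span ⟨x, hx, rfl⟩)
          (Submodule.smul_mem _ _ (Submodule.subset_span ⟨a, ha, rfl⟩))
      · rintro _ ⟨x, hx, rfl⟩
        rw [← sub_add_cancel (z x) (c x • z a), ← hz', ← hza]
        exact Submodule.add_mem _ (Submodule.subset_span ⟨x, hx, rfl⟩)
          (Submodule.smul_mem _ _ (Submodule.subset_span ⟨a, ha, rfl⟩))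
  · refine h.congr fun x hx => ?_
    rw [hz', not_imp_comm.1 (hcA x hx) ha, zero_smul, sub_zero]

/-- Once all other basis vectors lie in the hyperplane, a vector of the hyperplane has coefficient
`0` at `a`. This is the death step. -/
theorem diff_singleton (h : IsBasisOn z A W) (hW : ∀ y, y ∈ W' ↔ y ∈ W ∧ φ y = 0) (ha : a ∈ A)
    (hφ : φ (z a) ≠ 0) (hA : ∀ x ∈ A, x ≠ a → φ (z x) = 0) : IsBasisOn z (A \ {a}) W' := by
  refine ⟨h.1.mono Set.sdiff_subset, le_antisymm (Submodule.span_le.2 ?_) fun y hy => ?_⟩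
  · rintro _ ⟨x, hx, rfl⟩
    exact (hW _).2 ⟨h.mem hx.1, hA x hx.1 hx.2⟩
  · obtain ⟨hyW, hy0⟩ := (hW y).1 hy
    rw [← h.2, ← Set.insert_sdiff_self_of_mem ha, Set.image_insert_eq,
      Submodule.mem_span_insert] at hyW
    obtain ⟨t, v, hv, rfl⟩ := hyW
    have hle : Submodule.span ℝ (z '' (A \ {a})) ≤ LinearMap.ker φ := Submodule.span_le.2 (by
      rintro _ ⟨x, hx, rfl⟩
      exact hA x hx.1 hx.2)
    have hv0 : φ v = 0 := hle hv
    rw [map_add, map_smul, hv0, add_zero, smul_eq_mul] at hy0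
    rw [(mul_eq_zero.1 hy0).resolve_right hφ, zero_smul, zero_add]
    exact hv

end IsBasisOn

/-! ### The invariant of the algorithm -/

namespace AlgState

/-- The births in degree `p` whose bars contain `j`, where `U` is the set of unpaired births,
and `D` is the set of paired births with given deaths. -/
def barsAt (U D : Finset (ℕ × ℕ)) (death : ℕ × ℕ → ℕ) (p j : ℕ) : Set (ℕ × ℕ) :=
  {x | x.1 = p ∧ x.2 ≤ j ∧ (x ∈ U ∨ x ∈ D ∧ j ≤ death x)}

variable {V : Type u} [LinearOrder V] {m : ℕ} {F : SimplexwiseFiltration V m}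

/-- The invariant of the algorithm: at every earlier index the maintained chains, including those
of the bars that have been output, form bases of the harmonic chain groups. -/
structure Invariant (F : SimplexwiseFiltration V m) (i : ℕ) (s : AlgState V) (D : Finset (ℕ × ℕ))
    (death : ℕ × ℕ → ℕ) : Prop where
  disjoint : Disjoint D s.unpaired
  output : s.output = D.val.map fun x => ⟨x.1, x.2, death x, s.rep x⟩
  paired : ∀ x ∈ D, death x < i ∧ F.IsRep x.1 x.2 (death x) (s.rep x)
  unpaired : ∀ x ∈ s.unpaired, F.IsPartialRep x.1 x.2 i (s.rep x)
  basis : ∀ p, ∀ j ≤ i, IsBasisOn s.rep (barsAt s.unpaired D death p j) (har (F.K j) p)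

namespace Invariant

variable {i : ℕ} {s : AlgState V} {D : Finset (ℕ × ℕ)} {death : ℕ × ℕ → ℕ}

theorem initial (F : SimplexwiseFiltration V m) :
    Invariant F 0 (AlgState.initial V) ∅ fun _ => 0 where
  disjoint := Finset.disjoint_empty_left _
  output := rfl
  paired x hx := absurd hx (Finset.notMem_empty x)
  unpaired x hx := absurd hx (Finset.notMem_empty x)
  basis p j hj := by
    obtain rfl : j = 0 := Nat.le_zero.1 hj
    have hA : barsAt (AlgState.initial V).unpaired ∅ (fun _ => 0) p 0 = ∅ := by
      ext x
      simp [barsAt, AlgState.initial]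
    have hbot : har (F.K 0) p = ⊥ := by
      rw [eq_bot_iff, F.K_zero]
      intro z hz
      rw [Submodule.mem_bot]
      ext t
      by_contra ht
      exact (mem_chainGroup.1 (mem_har.1 hz).1 t ht).1
    rw [hA, hbot]
    exact ⟨linearIndepOn_empty _ _, by simp⟩

variable (h : Invariant F i s D death)

include h

theorem mem_barsAt_self {p : ℕ} {x : ℕ × ℕ} :
    x ∈ barsAt s.unpaired D death p i ↔ x.1 = p ∧ x ∈ s.unpaired := by
  constructor
  · rintro ⟨h1, h2, h3 | ⟨h3, h4⟩⟩
    · exact ⟨h1, h3⟩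
    · have := (h.paired x h3).1
      omega
  · rintro ⟨h1, h2⟩
    exact ⟨h1, (h.unpaired x h2).2.1, Or.inl h2⟩

theorem addBirth (hi : i < m) {p : ℕ} {z : Chain V} (hdim : (F.σ i).card = p + 1)
    (hpos : F.Positive i) (hz : z ∈ har (F.K (i + 1)) p) (hz' : z ∉ har (F.K i) p) :
    Invariant F (i + 1) (addBirth i p z s) D death := by
  obtain ⟨hother, hsame, -⟩ := SimplexwiseFiltration.Positive.birth hi hdim hpos
  -- All births recorded so far are at most `i`, so the new key is fresh and overwrites no chain.
  have hnotU : (p, i + 1) ∉ s.unpaired := fun hmem => by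
    have := (h.unpaired _ hmem).2.1
    simp at this
  have hnotD : (p, i + 1) ∉ D := fun hmem => by
    have h1 := (h.paired _ hmem).1
    have h2 := (h.paired _ hmem).2.1.2.1
    simp only at h2
    omega
  have hrep : ∀ x, x ≠ (p, i + 1) → (AlgState.addBirth i p z s).rep x = s.rep x := fun x hx =>
    Function.update_of_ne hx _ _
  have hrep' : (AlgState.addBirth i p z s).rep (p, i + 1) = z := Function.update_self _ _ _
  have hmono : ∀ r, har (F.K i) r ≤ har (F.K (i + 1)) r := fun r => by
    by_cases hr : r = p
    · subst hr
      exact fun y hy => ((hsame y).1 hy).1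
    · exact (hother r hr).ge
  have hU : (AlgState.addBirth i p z s).unpaired = Insert.insert (p, i + 1) s.unpaired := rfl
  have hbars : ∀ r, IsBasisOn (AlgState.addBirth i p z s).rep
      {x | x.1 = r ∧ x ∈ s.unpaired} (har (F.K i) r) := fun r => by
    have hA : {x | x.1 = r ∧ x ∈ s.unpaired} = barsAt s.unpaired D death r i :=
      Set.ext fun x => h.mem_barsAt_self.symm
    rw [hA]
    refine (h.basis r i le_rfl).congr fun x hx => (hrep x ?_).symm
    rintro rfl
    exact hnotU (h.mem_barsAt_self.1 hx).2
  refine ⟨?_, ?_, fun x hx => ?_, fun x hx => ?_, fun r j hj => ?_⟩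
  · rw [hU, Finset.disjoint_insert_right]
    exact ⟨hnotD, h.disjoint⟩
  · refine h.output.trans (Multiset.map_congr rfl fun x hx => ?_)
    rw [hrep x fun heq => hnotD (heq ▸ hx)]
  · rw [hrep x fun heq => hnotD (heq ▸ hx)]
    exact ⟨(h.paired x hx).1.trans (Nat.lt_succ_self i), (h.paired x hx).2⟩
  · rcases Finset.mem_insert.1 hx with rfl | hx
    · rw [hrep']
      refine ⟨Nat.succ_pos i, le_rfl, hi, fun j h1 h2 => ?_, hz'⟩
      obtain rfl : j = i + 1 := le_antisymm h2 h1
      exact hz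
    · rw [hrep x fun heq => hnotU (heq ▸ hx)]
      obtain ⟨h1, h2, h3, h4, h5⟩ := h.unpaired x hx
      refine ⟨h1, by omega, hi, fun j hj hj' => ?_, h5⟩
      rcases Nat.le_succ_iff.1 hj' with hj' | rfl
      · exact h4 j hj hj'
      · exact hmono _ (h4 i h2 le_rfl)
  · rcases Nat.le_succ_iff.1 hj with hj | rfl
    · have hA : barsAt (AlgState.addBirth i p z s).unpaired D death r j =
          barsAt s.unpaired D death r j := by
        ext x
        rw [hU]
        simp only [barsAt, Set.mem_ofPred_eq, Finset.mem_insert]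
        constructor
        · rintro ⟨h1, h2, (rfl | h3) | h3⟩
          · simp only at h2
            omega
          · exact ⟨h1, h2, Or.inl h3⟩
          · exact ⟨h1, h2, Or.inr h3⟩
        · rintro ⟨h1, h2, h3 | h3⟩
          · exact ⟨h1, h2, Or.inl (Or.inr h3)⟩
          · exact ⟨h1, h2, Or.inr h3⟩
      rw [hA]
      refine (h.basis r j hj).congr fun x hx => (hrep x ?_).symm
      rintro rfl
      have := hx.2.1
      simp only at this
      omega
    · have hA : ∀ x, x ∈ barsAt (AlgState.addBirth i p z s).unpaired D death r (i + 1) ↔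
          x.1 = r ∧ (x = (p, i + 1) ∨ x ∈ s.unpaired) := by
        intro x
        rw [hU]
        simp only [barsAt, Set.mem_ofPred_eq, Finset.mem_insert]
        constructor
        · rintro ⟨h1, h2, h3 | ⟨h3, h4⟩⟩
          · exact ⟨h1, h3⟩
          · have := (h.paired x h3).1
            omega
        · rintro ⟨h1, rfl | h3⟩
          · exact ⟨h1, le_rfl, Or.inl (Or.inl rfl)⟩
          · exact ⟨h1, (h.unpaired x h3).2.1.trans (Nat.le_succ i), Or.inl (Or.inr h3)⟩
      by_cases hr : r = p
      · subst hr
        have hA' : barsAt (AlgState.addBirth i r z s).unpaired D death r (i + 1) =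
            Insert.insert (r, i + 1) {x | x.1 = r ∧ x ∈ s.unpaired} := by
          ext x
          rw [hA, Set.mem_insert_iff, Set.mem_ofPred_eq]
          constructor
          · rintro ⟨h1, h2 | h2⟩
            · exact Or.inl h2
            · exact Or.inr ⟨h1, h2⟩
          · rintro (rfl | ⟨h1, h2⟩)
            · exact ⟨rfl, Or.inl rfl⟩
            · exact ⟨h1, Or.inr h2⟩
        rw [hA']
        refine (hbars r).insert (φ := Finsupp.lapply (F.σ i)) hsame (by rw [hrep']; exact hz) ?_
        rw [hrep']
        exact fun h0 => hz' ((hsame z).2 ⟨hz, h0⟩)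
      · have hA' : barsAt (AlgState.addBirth i p z s).unpaired D death r (i + 1) =
            {x | x.1 = r ∧ x ∈ s.unpaired} := by
          ext x
          rw [hA, Set.mem_ofPred_eq]
          refine and_congr_right fun h1 => ⟨fun h2 => h2.resolve_left ?_, Or.inr⟩
          rintro rfl
          exact hr h1.symm
        rw [hA', hother r hr]
        exact hbars r

/-- The pairing of a death does not divide by zero. -/
theorem coboundary_ne_zero (hi : i < m) {q b : ℕ} (hdim : (F.σ i).card = q + 2)
    (hneg : F.Negative i) (hb : b ∈ nonPersisting F i q s) :
    coboundary (s.rep (q, b)) (F.σ i) ≠ 0 := fun h0 => by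
  obtain ⟨-, hsame, -⟩ := SimplexwiseFiltration.Negative.death hi hdim hneg
  obtain ⟨-, h2, -, h4, -⟩ := h.unpaired _ hb.1
  exact hb.2 ((hsame _).2 ⟨h4 i h2 le_rfl, h0⟩)

/-- Evaluation on `∂σ` is nonzero on the harmonic group, hence on some member of the maintained
basis. -/
theorem nonPersisting_nonempty (hi : i < m) {q : ℕ} (hdim : (F.σ i).card = q + 2)
    (hneg : F.Negative i) : (nonPersisting F i q s).Nonempty := by
  obtain ⟨-, hsame, w, hw, hw0⟩ := SimplexwiseFiltration.Negative.death hi hdim hneg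
  obtain ⟨⟨q', b⟩, hx, hx0⟩ := (h.basis q i le_rfl).exists_ne_zero
    (φ := dot.flip (simplexBoundary (F.σ i))) hw hw0
  obtain ⟨rfl, hU⟩ := h.mem_barsAt_self.1 hx
  exact ⟨b, hU, fun hmem => hx0 ((hsame _).1 hmem).2⟩

/-- The delicate point is that the update also alters chains in the bases at earlier indices;
minimality of `b` makes it a change of basis at each of them. -/
theorem pairDeath (hi : i < m) {q b : ℕ} (hdim : (F.σ i).card = q + 2) (hneg : F.Negative i)
    (hb : IsLeast (nonPersisting F i q s) b) :
    Invariant F (i + 1) (pairDeath F i q b s) (Insert.insert (q, b) D)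
      (Function.update death (q, b) i) := by
  classical
  obtain ⟨hother, hsame, -⟩ := SimplexwiseFiltration.Negative.death hi hdim hneg
  have hα := h.coboundary_ne_zero hi hdim hneg hb.1
  obtain ⟨hbU, hbnot⟩ := hb.1
  have hbD : (q, b) ∉ D := fun hD => Finset.disjoint_left.1 h.disjoint hD hbU
  have hbrep := h.unpaired _ hbU
  have hle : ∀ r, har (F.K (i + 1)) r ≤ har (F.K i) r := fun r => by
    by_cases hr : r = q
    · subst hr
      exact fun y hy => ((hsame y).1 hy).1
    · exact (hother r hr).ge
  -- The elimination coefficients, extended by zero so that one formula describes the new chain at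
  -- every key.
  let c : ℕ × ℕ → ℝ := fun x => if x.1 = q ∧ x.2 ∈ nonPersisting F i q s \ {b} then
    coboundary (s.rep x) (F.σ i) / coboundary (s.rep (q, b)) (F.σ i) else 0
  have hc : ∀ x, c x ≠ 0 → x.1 = q ∧ x ∈ s.unpaired ∧ b < x.2 := by
    intro x hx
    have hcond : x.1 = q ∧ x.2 ∈ nonPersisting F i q s \ {b} := by
      by_contra hcond
      exact hx (if_neg hcond)
    obtain ⟨rfl, h2, h3⟩ := hcond
    exact ⟨rfl, h2.1, lt_of_le_of_ne (hb.2 h2) fun heq => h3 heq.symm⟩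
  have hrep : ∀ x, (AlgState.pairDeath F i q b s).rep x = s.rep x - c x • s.rep (q, b) := by
    intro x
    by_cases hcond : x.1 = q ∧ x.2 ∈ nonPersisting F i q s \ {b}
    · simp only [AlgState.pairDeath, c, if_pos hcond]
    · simp only [AlgState.pairDeath, c, if_neg hcond, zero_smul, sub_zero]
  have hcb : c (q, b) = 0 := by
    by_contra hne
    exact lt_irrefl _ (hc _ hne).2.2
  have hrep0 : ∀ x, c x = 0 → (AlgState.pairDeath F i q b s).rep x = s.rep x := fun x hx => by
    rw [hrep, hx, zero_smul, sub_zero]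
  have hcD : ∀ x ∈ D, c x = 0 := fun x hx => by
    by_contra hne
    exact Finset.disjoint_left.1 h.disjoint hx (hc x hne).2.1
  have hdeath : ∀ x ∈ D, Function.update death (q, b) i x = death x := fun x hx =>
    Function.update_of_ne (fun heq => hbD (by rwa [← heq])) _ _
  have hU : (AlgState.pairDeath F i q b s).unpaired = s.unpaired.erase (q, b) := rfl
  have hbars : ∀ r, ∀ j ≤ i, IsBasisOn (AlgState.pairDeath F i q b s).rep
      (barsAt s.unpaired D death r j) (har (F.K j) r) := fun r j hj => by
    refine (h.basis r j hj).sub_smul hcb (fun x hx hx0 => ?_) hrep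
    -- A modified chain is younger than the pivot, so the pivot is alive wherever that chain is.
    obtain ⟨h1, h2, h3⟩ := hc x hx0
    exact ⟨h1.symm.trans hx.1, h3.le.trans hx.2.1, Or.inl hbU⟩
  have hzero : ∀ x ∈ s.unpaired, x.1 = q → x ≠ (q, b) →
      coboundary ((AlgState.pairDeath F i q b s).rep x) (F.σ i) = 0 := by
    rintro ⟨q', b'⟩ hx rfl hne
    rw [hrep, coboundary_eq_dot, map_sub, map_smul, LinearMap.sub_apply, LinearMap.smul_apply,
      ← coboundary_eq_dot, ← coboundary_eq_dot]
    have hne' : b' ≠ b := fun heq => hne (by rw [heq])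
    by_cases hmem : s.rep (q', b') ∈ har (F.K (i + 1)) q'
    · have hc0 : c (q', b') = 0 := if_neg fun hcond => hcond.2.1.2 hmem
      rw [hc0, ((hsame _).1 hmem).2, zero_smul, sub_zero]
    · have hc1 : c (q', b') = coboundary (s.rep (q', b')) (F.σ i) /
          coboundary (s.rep (q', b)) (F.σ i) := if_pos ⟨rfl, ⟨hx, hmem⟩, hne'⟩
      rw [hc1, smul_eq_mul, div_mul_cancel₀ _ hα, sub_self]
  have hlast : ∀ r x, x ∈ barsAt (s.unpaired.erase (q, b)) (Insert.insert (q, b) D)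
      (Function.update death (q, b) i) r (i + 1) ↔
      x ∈ barsAt s.unpaired D death r i ∧ x ≠ (q, b) := by
    intro r x
    rw [h.mem_barsAt_self]
    simp only [barsAt, Set.mem_ofPred_eq, Finset.mem_erase, Finset.mem_insert]
    constructor
    · rintro ⟨h1, h2, ⟨h3, h4⟩ | ⟨rfl | h3, h4⟩⟩
      · exact ⟨⟨h1, h4⟩, h3⟩
      · rw [Function.update_self] at h4
        omega
      · rw [hdeath x h3] at h4
        have := (h.paired x h3).1
        omega
    · rintro ⟨⟨h1, h2⟩, h3⟩
      exact ⟨h1, (h.unpaired x h2).2.1.trans (Nat.le_succ i), Or.inl ⟨h3, h2⟩⟩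
  -- Closing the pivot's bar at `i` does not affect which bars contain an index `j ≤ i`.
  have hearly : ∀ r, ∀ j ≤ i, barsAt (s.unpaired.erase (q, b)) (Insert.insert (q, b) D)
      (Function.update death (q, b) i) r j = barsAt s.unpaired D death r j := by
    intro r j hj
    ext x
    simp only [barsAt, Set.mem_ofPred_eq, Finset.mem_erase, Finset.mem_insert]
    refine and_congr_right fun h1 => and_congr_right fun h2 => ?_
    by_cases hx : x = (q, b)
    · subst hx
      simp [hbU, hj]
    · simp [hx]
  refine ⟨?_, ?_, fun x hx => ?_, fun x hx => ?_, fun r j hj => ?_⟩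
  · rw [hU, Finset.disjoint_insert_left]
    exact ⟨Finset.notMem_erase _ _, h.disjoint.mono_right (Finset.erase_subset _ _)⟩
  · rw [Finset.insert_val_of_notMem hbD, Multiset.map_cons, Function.update_self, hrep0 _ hcb]
    refine congrArg (Multiset.cons _) (h.output.trans (Multiset.map_congr rfl fun x hx => ?_))
    rw [hdeath x hx, hrep0 x (hcD x hx)]
  · rcases Finset.mem_insert.1 hx with rfl | hx
    · rw [Function.update_self, hrep0 _ hcb]
      exact ⟨Nat.lt_succ_self i, hbrep, fun _ => hbnot⟩
    · rw [hdeath x hx, hrep0 x (hcD x hx)]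
      exact ⟨(h.paired x hx).1.trans (Nat.lt_succ_self i), (h.paired x hx).2⟩
  · rw [hU, Finset.mem_erase] at hx
    obtain ⟨hne, hx⟩ := hx
    obtain ⟨h1, h2, h3, h4, h5⟩ := h.unpaired x hx
    have h4' : ∀ j, x.2 ≤ j → j ≤ i →
        (AlgState.pairDeath F i q b s).rep x ∈ har (F.K j) x.1 := fun j hj hj' =>
      (hbars x.1 j hj').mem ⟨rfl, hj, Or.inl hx⟩
    refine ⟨h1, h2.trans (Nat.le_succ i), hi, fun j hj hj' => ?_, fun hmem => h5 ?_⟩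
    · rcases Nat.le_succ_iff.1 hj' with hj' | rfl
      · exact h4' j hj hj'
      · by_cases hq : x.1 = q
        · rw [hq]
          exact (hsame _).2 ⟨hq ▸ h4' i h2 le_rfl, hzero x hx hq hne⟩
        · rw [← hother _ hq]
          exact h4' i h2 le_rfl
    -- The pivot is harmonic at `x.2 - 1`, because `b < x.2`. Adding the multiple back would put the
    -- old chain there too, contradicting its birth.
    · by_cases hcx : c x = 0
      · rwa [hrep0 x hcx] at hmem
      · obtain ⟨hq, -, hlt⟩ := hc x hcx
        rw [hrep] at hmem
        rw [← sub_add_cancel (s.rep x) (c x • s.rep (q, b))]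
        refine Submodule.add_mem _ hmem (Submodule.smul_mem _ _ ?_)
        rw [hq]
        exact hbrep.2.2.2.1 _ (by simp only; omega) (by omega)
  · rw [hU]
    rcases Nat.le_succ_iff.1 hj with hj | rfl
    · rw [hearly r j hj]
      exact hbars r j hj
    · by_cases hr : r = q
      · subst hr
        have hA : barsAt (s.unpaired.erase (r, b)) (Insert.insert (r, b) D)
            (Function.update death (r, b) i) r (i + 1) =
            barsAt s.unpaired D death r i \ {(r, b)} := Set.ext fun x => hlast r x
        rw [hA]
        refine (hbars r i le_rfl).diff_singleton (φ := dot.flip (simplexBoundary (F.σ i))) hsame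
          (h.mem_barsAt_self.2 ⟨rfl, hbU⟩) (by rw [hrep0 _ hcb]; exact hα) fun x hx hne => ?_
        obtain ⟨h1, h2⟩ := h.mem_barsAt_self.1 hx
        exact hzero x h2 h1 hne
      · have hA : barsAt (s.unpaired.erase (q, b)) (Insert.insert (q, b) D)
            (Function.update death (q, b) i) r (i + 1) = barsAt s.unpaired D death r i := by
          ext x
          rw [hlast]
          refine ⟨And.left, fun hx => ⟨hx, ?_⟩⟩
          rintro rfl
          exact hr hx.1.symm
        rw [hA, ← hother r hr]
        exact hbars r i le_rfl

end Invariant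

theorem Reaches.exists_invariant {i : ℕ} {s : AlgState V} (h : Reaches F i s) :
    ∃ D death, Invariant F i s D death := by
  induction h with
  | start => exact ⟨_, _, Invariant.initial F⟩
  | next hi _ hstep ih =>
    obtain ⟨D, death, h⟩ := ih
    cases hstep with
    | positive p z hdim hpos hz hz' => exact ⟨_, _, h.addBirth hi hdim hpos hz hz'⟩
    | negative q b hdim hneg hb => exact ⟨_, _, h.pairDeath hi hdim hneg hb⟩

theorem Reaches.exists_step {i : ℕ} {s : AlgState V} (h : Reaches F i s) (hi : i < m) :
    ∃ s', Step F i s s' := by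
  obtain ⟨D, death, hinv⟩ := h.exists_invariant
  rcases SimplexwiseFiltration.birth_or_death (F := F) hi with
    ⟨p, hdim, hpos, -, hsame, z, hz, hz0⟩ | ⟨q, hdim, hneg, -⟩
  · exact ⟨_, Step.positive p z hdim hpos hz fun hmem => hz0 ((hsame z).1 hmem).2⟩
  · obtain ⟨b, hb, hmin⟩ := WellFounded.has_min Nat.lt_wfRel.wf _
      (hinv.nonPersisting_nonempty hi hdim hneg)
    exact ⟨_, Step.negative q b hdim hneg ⟨hb, fun b' hb' => not_lt.1 (hmin b' hb')⟩⟩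

end AlgState

/-! ### The barcodes -/

/-- Passes from bars indexed by a finite set of keys to the finite index type required by an adapted
family. -/
theorem ZigzagModule.isBarcode_of_isBasisOn {E : Type u} [AddCommGroup E] [Module ℝ E] {k : ℕ}
    {W : ℕ → Submodule ℝ E} (hW : ∀ i < k, W i ≤ W (i + 1) ∨ W (i + 1) ≤ W i) {ι : Type}
    (T : Finset ι) (I : ι → ℕ × ℕ) (z : ι → E) (hle : ∀ x ∈ T, (I x).1 ≤ (I x).2 ∧ (I x).2 ≤ k)
    (hbasis : ∀ i ≤ k, IsBasisOn z {x | x ∈ T ∧ (I x).1 ≤ i ∧ i ≤ (I x).2} (W i))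
    (hbirth : ∀ x ∈ T, 0 < (I x).1 → z x ∉ W ((I x).1 - 1))
    (hdeath : ∀ x ∈ T, (I x).2 < k → z x ∉ W ((I x).2 + 1)) :
    (ofNested k W hW).IsBarcode (T.val.map I) := by
  have himage : ∀ i, ((↑) : T → ι) '' (alive (fun x : T => I x) i : Set T) =
      {x | x ∈ T ∧ (I x).1 ≤ i ∧ i ≤ (I x).2} := by
    intro i
    ext x
    constructor
    · rintro ⟨y, hy, rfl⟩
      exact ⟨y.2, (mem_alive (I := fun x : T => I x)).1 (Finset.mem_coe.1 hy)⟩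
    · rintro ⟨hx, h⟩
      exact ⟨⟨x, hx⟩, Finset.mem_coe.2 (mem_alive.2 h), rfl⟩
  have hadapted : IsAdapted k W (fun x : T => I x) (fun x : T => z x) := by
    refine ⟨fun x => hle x x.2, fun i hi => ?_, fun i hi => ?_, fun x => hbirth x x.2,
      fun x => hdeath x x.2⟩
    · have h := (hbasis i hi).1
      rw [← himage] at h
      exact h.comp_of_image Subtype.val_injective.injOn
    · rw [← (hbasis i hi).2, ← himage, Set.image_image]
  have h := hadapted.isBarcode hW
  rwa [show (Finset.univ : Finset T).val.map (fun x : T => I x) = T.val.map I from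
    Multiset.attach_map_val' T.val I] at h

/-! ### Passing from single degrees to the total harmonic group. -/

/-- The projection of chains to the degree `p`. -/
def degreeProj (V : Type u) (p : ℕ) : Chain V →ₗ[ℝ] Chain V :=
  (Finsupp.supported ℝ ℝ {s : Finset V | s.card = p + 1}).subtype ∘ₗ
    Finsupp.restrictDom ℝ ℝ {s : Finset V | s.card = p + 1}

theorem degreeProj_apply {V : Type u} (p : ℕ) (z : Chain V) (s : Finset V) :
    degreeProj V p z s = if s.card = p + 1 then z s else 0 := by
  simp [degreeProj, Finsupp.restrictDom_apply, Finsupp.filter_apply]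

variable {V : Type u} [LinearOrder V] {m : ℕ} {F : SimplexwiseFiltration V m}

theorem degreeProj_of_mem_har {K : PreAbstractSimplicialComplex V} {p r : ℕ} {z : Chain V}
    (hz : z ∈ har K r) : degreeProj V p z = if r = p then z else 0 := by
  ext s
  rw [degreeProj_apply]
  by_cases hs : z s = 0
  · split_ifs <;> simp [hs]
  · have := (mem_chainGroup.1 (mem_har.1 hz).1 s hs).2
    by_cases hr : r = p
    · rw [if_pos hr, if_pos (by omega)]
    · rw [if_neg hr, if_neg (by omega), Finsupp.zero_apply]

/-- The complex `L` only certifies that `z` is homogeneous of degree `p`. This carries the endpoint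
conditions of a bar over to the total module. -/
theorem mem_har_of_mem_harTotal {K L : PreAbstractSimplicialComplex V} {p : ℕ} {z : Chain V}
    (hz : z ∈ harTotal K) (hp : z ∈ har L p) : z ∈ har K p := by
  have hle : harTotal K ≤ (har K p).comap (degreeProj V p) := iSup_le fun r y hy => by
    rw [Submodule.mem_comap, degreeProj_of_mem_har hy]
    split_ifs with hr
    · exact hr ▸ hy
    · exact Submodule.zero_mem _
  have h := hle hz
  rwa [Submodule.mem_comap, degreeProj_of_mem_har hp, if_pos rfl] at h

/-- Degree projections split any linear relation into relations within single degrees. -/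
theorem isBasisOn_harTotal {K : PreAbstractSimplicialComplex V} {z : ℕ × ℕ → Chain V}
    {A : Set (ℕ × ℕ)} (h : ∀ p, IsBasisOn z {x | x.1 = p ∧ x ∈ A} (har K p)) :
    IsBasisOn z A (harTotal K) := by
  constructor
  · rw [linearIndepOn_iff]
    intro l hl h0
    ext x
    have hfilter : l.filter (fun y => y.1 = x.1) = 0 := by
      refine linearIndepOn_iff.1 (h x.1).1 _ (fun y hy => ?_) ?_
      · rw [Finset.mem_coe, Finsupp.support_filter, Finset.mem_filter] at hy
        exact ⟨hy.2, hl hy.1⟩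
      · rw [← map_zero (degreeProj V x.1), ← h0, Finsupp.linearCombination_apply,
          Finsupp.linearCombination_apply, Finsupp.sum, Finsupp.sum, map_sum,
          Finsupp.support_filter, Finset.sum_filter]
        refine Finset.sum_congr rfl fun y hy => ?_
        have hmem : z y ∈ har K y.1 := (h y.1).mem ⟨rfl, hl hy⟩
        rw [map_smul, degreeProj_of_mem_har hmem]
        split_ifs with hyx
        · rw [Finsupp.filter_apply_pos (fun y : ℕ × ℕ => y.1 = x.1) l hyx]
        · rw [smul_zero]
    have := DFunLike.congr_fun hfilter x
    rwa [Finsupp.filter_apply_pos (fun y : ℕ × ℕ => y.1 = x.1) l rfl] at this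
  · have hA : A = ⋃ p, {x | x.1 = p ∧ x ∈ A} := by
      ext x
      simp
    rw [hA, Set.image_iUnion, Submodule.span_iUnion]
    exact iSup_congr fun p => (h p).2

/-! ### Reading the barcodes off the final state. -/

namespace AlgState.Invariant

variable {s : AlgState V} {D : Finset (ℕ × ℕ)} {death : ℕ × ℕ → ℕ} (h : Invariant F m s D death)

include h

/-- Paired and unpaired births are merged into one indexed family, an unpaired birth being given the
right endpoint `m`. -/
theorem exists_bars : ∃ (T : Finset (ℕ × ℕ)) (last : ℕ × ℕ → ℕ),
    s.finalBars m = T.val.map (fun x => ⟨x.1, x.2, last x, s.rep x⟩) ∧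
    (∀ x ∈ T, F.IsRep x.1 x.2 (last x) (s.rep x)) ∧
    ∀ p, ∀ j ≤ m, IsBasisOn s.rep {x | x.1 = p ∧ x ∈ T ∧ x.2 ≤ j ∧ j ≤ last x} (har (F.K j) p) := by
  classical
  let last : ℕ × ℕ → ℕ := fun x => if x ∈ s.unpaired then m else death x
  have hlastU : ∀ x ∈ s.unpaired, last x = m := fun x hx => if_pos hx
  have hlastD : ∀ x ∈ D, last x = death x := fun x hx =>
    if_neg (Finset.disjoint_left.1 h.disjoint hx)
  refine ⟨D.disjUnion s.unpaired h.disjoint, last, ?_, fun x hx => ?_, fun p j hj => ?_⟩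
  · rw [finalBars, h.output, Finset.disjUnion_val, Multiset.map_add]
    congr 1
    · exact Multiset.map_congr rfl fun x hx => by rw [hlastD x hx]
    · exact Multiset.map_congr rfl fun x hx => by rw [hlastU x hx]
  · rcases Finset.mem_disjUnion.1 hx with hx | hx
    · rw [hlastD x hx]
      exact (h.paired x hx).2
    · rw [hlastU x hx]
      exact ⟨h.unpaired x hx, fun hlt => absurd hlt (lt_irrefl m)⟩
  · have hA : {x | x.1 = p ∧ x ∈ D.disjUnion s.unpaired h.disjoint ∧ x.2 ≤ j ∧ j ≤ last x} =
        barsAt s.unpaired D death p j := by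
      ext x
      simp only [barsAt, Set.mem_ofPred_eq, Finset.mem_disjUnion]
      constructor
      · rintro ⟨h1, h2 | h2, h3, h4⟩
        · exact ⟨h1, h3, Or.inr ⟨h2, hlastD x h2 ▸ h4⟩⟩
        · exact ⟨h1, h3, Or.inl h2⟩
      · rintro ⟨h1, h2, h3 | ⟨h3, h4⟩⟩
        · exact ⟨h1, Or.inr h3, h2, (hlastU x h3).symm ▸ hj⟩
        · exact ⟨h1, Or.inl h3, h2, (hlastD x h3).symm ▸ h4⟩
    rw [hA]
    exact h.basis p j hj

theorem isBarcode :
    F.harTotalModule.IsBarcode ((s.finalBars m).map Bar.interval) ∧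
      (∀ p, (F.harModule p).IsBarcode
        (((s.finalBars m).filter fun B => B.degree = p).map Bar.interval)) ∧
      ∀ B ∈ s.finalBars m, F.IsRep B.degree B.birth B.death B.rep := by
  obtain ⟨T, last, hbars, hrep, hbasis⟩ := h.exists_bars
  rw [hbars]
  refine ⟨?_, fun p => ?_, fun B hB => ?_⟩
  · rw [Multiset.map_map]
    refine ZigzagModule.isBarcode_of_isBasisOn F.harTotal_nested T (fun x => (x.2, last x)) s.rep
      (fun x hx => ⟨(hrep x hx).1.2.1, (hrep x hx).1.2.2.1⟩)
      (fun i hi => isBasisOn_harTotal fun p => hbasis p i hi) (fun x hx _ hmem => ?_)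
      (fun x hx hlt hmem => ?_)
    · obtain ⟨⟨-, h2, -, h4, h5⟩, -⟩ := hrep x hx
      exact h5 (mem_har_of_mem_harTotal hmem (h4 x.2 le_rfl h2))
    · obtain ⟨⟨-, h2, -, h4, -⟩, h6⟩ := hrep x hx
      exact h6 hlt (mem_har_of_mem_harTotal hmem (h4 x.2 le_rfl h2))
  · rw [Multiset.filter_map, Multiset.map_map]
    refine ZigzagModule.isBarcode_of_isBasisOn (F.har_nested_degree p)
      (T.filter fun x => x.1 = p) (fun x => (x.2, last x)) s.rep (fun x hx => ?_) (fun i hi => ?_)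
      (fun x hx _ => ?_) (fun x hx => ?_)
    · have hx := hrep x (Finset.mem_filter.1 hx).1
      exact ⟨hx.1.2.1, hx.1.2.2.1⟩
    · have hA : {x | x ∈ T.filter (fun x => x.1 = p) ∧ x.2 ≤ i ∧ i ≤ last x} =
          {x | x.1 = p ∧ x ∈ T ∧ x.2 ≤ i ∧ i ≤ last x} := by
        ext x
        simp only [Finset.mem_filter, Set.mem_ofPred_eq]
        tauto
      rw [hA]
      exact hbasis p i hi
    · obtain ⟨hxT, rfl⟩ := Finset.mem_filter.1 hx
      exact (hrep x hxT).1.2.2.2.2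
    · obtain ⟨hxT, rfl⟩ := Finset.mem_filter.1 hx
      exact (hrep x hxT).2
  · obtain ⟨x, hx, rfl⟩ := Multiset.mem_map.1 hB
    exact hrep x hx

end AlgState.Invariant

end HarmonicChain

end

theorem mainTheorem2 {V : Type*} [LinearOrder V] {m : ℕ}
    (F : HarmonicChain.SimplexwiseFiltration V m) :
    -- The algorithm never gets stuck, whatever harmonic cycles were chosen before, and it never
    -- divides by zero.
    (∀ i < m, ∀ s, HarmonicChain.AlgState.Reaches F i s →
      (∃ s', HarmonicChain.AlgState.Step F i s s') ∧
      (∀ q bs, (F.σ i).card = q + 2 → F.Negative i →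
        IsLeast (HarmonicChain.AlgState.nonPersisting F i q s) bs →
        HarmonicChain.coboundary (s.rep (q, bs)) (F.σ i) ≠ 0)) ∧
    -- Before iteration `i` the chain maintained for an unpaired birth `b` is a partial
    -- representative for `[b, i]`.
    (∀ i ≤ m, ∀ s, HarmonicChain.AlgState.Reaches F i s → ∀ p b, (p, b) ∈ s.unpaired →
      F.IsPartialRep p b i (s.rep (p, b))) ∧
    -- The output of every complete run is the harmonic chain barcode, in each degree and in
    -- total, and every output bar comes with a harmonic representative.
    (∀ s, HarmonicChain.AlgState.Reaches F m s →
      F.harTotalModule.IsBarcode ((s.finalBars m).map HarmonicChain.Bar.interval) ∧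
      (∀ p, (F.harModule p).IsBarcode
        (((s.finalBars m).filter fun B => B.degree = p).map HarmonicChain.Bar.interval)) ∧
      ∀ B ∈ s.finalBars m, F.IsRep B.degree B.birth B.death B.rep) := by
  refine ⟨fun i hi s hs => ⟨hs.exists_step hi, fun q bs hdim hneg hbs => ?_⟩,
    fun i _ s hs p b hb => ?_, fun s hs => ?_⟩
  · obtain ⟨D, death, h⟩ := hs.exists_invariant
    exact h.coboundary_ne_zero hi hdim hneg hbs.1
  · obtain ⟨D, death, h⟩ := hs.exists_invariant
    exact h.unpaired _ hb
  · obtain ⟨D, death, h⟩ := hs.exists_invariant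
    exact h.isBarcode
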